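/- **Theorem 1.5.** Let $S$ be a nonempty countable set, let $\{0,1\}^S$ carry the product topology, its Borel $\sigma$-algebra and the coordinatewise order, and for $p\in[0,1]$ let $\pi_p$ be the law on $\{0,1\}^S$ of independent coordinates each equal to $1$ with probability $p$ and $0$ otherwise. For probability measures $\mu,\mu'$ on $\{0,1\}^S$ write $\mu\preceq\mu'$ if $\int f\,d\mu\le\int f\,d\mu'$ for every continuous increasing $f:\{0,1\}^S\to\mathbb R$. For $\epsilon\in(0,1)$ let $\mu^{(+,\epsilon)}$ (respectively $\mu^{(-,\epsilon)}$) be the law of the configuration obtained by choosing an element of $\{0,1\}^S$ according to $\mu$ and then independently changing each $0$ to a $1$ (respectively each $1$ to a $0$) with probability $\epsilon$. Put $p_{\max,\mu}=\sup\{p\in[0,1]:\pi_p\preceq\mu\}$; the supremum is attained. Consider the following properties of a probability measure $\mu$ on $\{0,1\}^S$: - (I) $\mu$ is uniformly upwards extractable: there are $\epsilon\in(0,1)$ and a probability measure $\nu$ on $\{0,1\}^S$ with $\mu=\nu^{(+,\epsilon)}$. - (II) $\mu$ is uniformly insertion tolerant: there is $\epsilon>0$ such that for every $s\in S$, $\mu\bigl(\sigma(s)=1\mid\sigma(S\setminus\{s\})\bigr)\ge\epsilon$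 $\mu$-almost surely. - (III) $\mu$ is rigid: there is no $\epsilon\in(0,1)$ with $\pi_{p_{\max,\mu}}\preceq\mu^{(-,\epsilon)}$. - (IV) There is a $p>0$ such that $\pi_p\preceq\mu$. Then, for every such $S$ and $\mu$, (I) $\Rightarrow$ (II) $\Rightarrow$ (IV) and (I) $\Rightarrow$ (III) $\Rightarrow$ (IV). None of the four reverse implications (II) $\Rightarrow$ (I), (IV) $\Rightarrow$ (II), (III) $\Rightarrow$ (I), (IV) $\Rightarrow$ (III) holds in general, and (III) does not imply (II) in general. Moreover, for each of these five nonimplications there is a translation invariant probability measure on $\{0,1\}^{\mathbb Z}$ that satisfies the premise but not the conclusion. -/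

import Mathlib

open MeasureTheory
open scoped ProbabilityTheory

namespace Domination

variable {S : Type*}

/-- The product measure `π_p` on `{0,1}^S`: the coordinates are independent, each equal to `1`
(`true`) with probability `p` and to `0` (`false`) with probability `1 - p`. -/
noncomputable def prodBer (S : Type*) (p : unitInterval) : Measure (S → Bool) :=
  Measure.infinitePi fun _ : S => ProbabilityTheory.bernoulliMeasure true false p

/-- `μ^{(+,ε)}`: choose a configuration `σ` according to `μ`, and then independently change each
`0` to a `1` with probability `ε`. The independent configuration `η ∼ π_ε` marks the sites at
which a `0` is to be changed. -/
noncomputable def plusNoise (μ : Measure (S → Bool)) (ε : unitInterval) : Measure (S → Bool) :=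
  (μ.prod (prodBer S ε)).map fun x s => x.1 s || x.2 s

/-- `μ^{(-,ε)}`: choose a configuration `σ` according to `μ`, and then independently change each
`1` to a `0` with probability `ε`. The independent configuration `η ∼ π_ε` marks the sites at
which a `1` is to be changed. -/
noncomputable def minusNoise (μ : Measure (S → Bool)) (ε : unitInterval) : Measure (S → Bool) :=
  (μ.prod (prodBer S ε)).map fun x s => x.1 s && !x.2 s

/-- Stochastic domination `μ ⪯ μ'`: `∫ f dμ ≤ ∫ f dμ'` for every continuous increasing
`f : {0,1}^S → ℝ` (product topology and coordinatewise order). -/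
def StochDom (μ μ' : Measure (S → Bool)) : Prop :=
  ∀ f : (S → Bool) → ℝ, Continuous f → Monotone f → ∫ σ, f σ ∂μ ≤ ∫ σ, f σ ∂μ'

/-- The pair `(μ₁, μ₂)` is downwards movable: `μ₁ ⪯ μ₂` and `μ₁ ⪯ μ₂^{(-,ε)}` for some
`ε ∈ (0,1)`. -/
def DownwardsMovable (μ₁ μ₂ : Measure (S → Bool)) : Prop :=
  StochDom μ₁ μ₂ ∧ ∃ ε : unitInterval, 0 < ε ∧ ε < 1 ∧ StochDom μ₁ (minusNoise μ₂ ε)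

/-- `p_{max,μ} = sup {p ∈ [0,1] : π_p ⪯ μ}`, the supremum being taken in `[0,1]`. -/
noncomputable def pMax (μ : Measure (S → Bool)) : unitInterval :=
  sSup {p : unitInterval | StochDom (prodBer S p) μ}

/-- `μ` is rigid if the pair `(π_{p_{max,μ}}, μ)` is not downwards movable. -/
def Rigid (μ : Measure (S → Bool)) : Prop :=
  ¬ DownwardsMovable (prodBer S (pMax μ)) μ

/-- `ε`-insertion tolerance: for every site `s`, the conditional probability that `σ(s) = 1`
given the configuration on `S \ {s}` is at least `ε` almost surely. -/
def InsertionTolerant (μ : Measure (S → Bool)) (ε : ℝ) : Prop :=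
  ∀ s : S, ∀ᵐ σ ∂μ,
    ε ≤ (μ⟦{τ : S → Bool | τ s = true} | cylinderEvents ({s}ᶜ : Set S)⟧) σ

/-- `μ` is uniformly insertion tolerant. -/
def UniformlyInsertionTolerant (μ : Measure (S → Bool)) : Prop :=
  ∃ ε : ℝ, 0 < ε ∧ InsertionTolerant μ ε

/-- `μ` is `ε`-upwards extractable: `μ = ν^{(+,ε)}` for some probability measure `ν`. -/
def UpwardsExtractable (μ : Measure (S → Bool)) (ε : unitInterval) : Prop :=
  ∃ ν : Measure (S → Bool), IsProbabilityMeasure ν ∧ μ = plusNoise ν ε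

/-- `μ` is uniformly upwards extractable: it is `ε`-upwards extractable for some
`ε ∈ (0,1)`. -/
def UniformlyUpwardsExtractable (μ : Measure (S → Bool)) : Prop :=
  ∃ ε : unitInterval, 0 < ε ∧ ε < 1 ∧ UpwardsExtractable μ ε

/-- `μ` stochastically dominates `π_p` for some `p ∈ (0,1]`. -/
def DominatesProduct (μ : Measure (S → Bool)) : Prop :=
  ∃ p : unitInterval, 0 < p ∧ StochDom (prodBer S p) μ

/-- Translation invariance of a measure on `{0,1}^ℤ`. -/
def TranslationInvariant (μ : Measure (ℤ → Bool)) : Prop :=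
  ∀ k : ℤ, μ.map (fun (σ : ℤ → Bool) (i : ℤ) => σ (i + k)) = μ

end Domination

/-! Implications. The passage from local to global domination is a hybrid argument,
`stochDom_of_resample_block`: if replacing any single block of sites by fresh `π_p` values never
raises the expectation of an increasing function, replacing the blocks one after another gives `π_p
⪯ μ`. With one-site blocks, insertion tolerance is what is needed, so (II) gives (IV). Under plus
noise, the noise bit at a site is independent of everything off that site and forces occupation, so
(I) gives (II). For (III) from (I), suppose `π_{p_max} ⪯ μ^{(-,δ)}` and add a small plus noise to
both sides. The left side becomes a strictly denser product measure, while the right side still lies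
below `μ`, because the noise already present in `μ` absorbs the deletion and reinsertion; this
contradicts maximality. Finally, if `p_max = 0` then `μ` cannot be rigid, since `π_0` lies below
every law; so (III) gives (IV).

Three measures give the five counterexamples.

Maxima of neighbouring fair bits, `neighbourMaxLaw`: two vacant sites at distance two force a
vacancy between them, so insertion tolerance fails. The law dominates `π_{1/2}`, but minus noise
raises its vacancy rate on long intervals strictly above `1/2`, so it is rigid.

Independent constant blocks of size `n`, vacant with probability `(3/4)^n / 2`, mixed over `n = 2^j`
and over phases: the vacancy rates force `p_max ≤ 1/4`, yet `π_{1/4}` is still dominated after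
deletion with probability `1/2`. One scale alone would leave the factor `1/2` in the bound on
`p_max`; it disappears only as `n → ∞`.

Blocks uniform up to a bias of their parity, mixed in the same way: flipping at most two underlying
bits changes one chosen site only, which gives insertion tolerance uniformly in the scale. Undoing
plus noise would multiply the parity correlation of a block by `(1-ε)^{-n}`, which beats the
polynomial mixture weight, so no extraction is possible. Nonnegativity of all sign correlations
(Griffiths) prevents cancellation. -/

namespace Domination

open ProbabilityTheory
open scoped ENNReal

set_option linter.unusedSectionVars false

variable {S : Type*}

/-! ### Independence and resampling for infinite products. -/

section ProductMeasures

variable {ι : Type*}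

/-- A coordinatewise function of two independent product measures has a product law. -/
lemma map_prod_infinitePi {X Y Z : ι → Type*} [∀ i, MeasurableSpace (X i)]
    [∀ i, MeasurableSpace (Y i)] [∀ i, MeasurableSpace (Z i)] (μ : ∀ i, Measure (X i))
    (ν : ∀ i, Measure (Y i)) [∀ i, IsProbabilityMeasure (μ i)] [∀ i, IsProbabilityMeasure (ν i)]
    (φ : ∀ i, X i × Y i → Z i) (hφ : ∀ i, Measurable (φ i)) :
    ((Measure.infinitePi μ).prod (Measure.infinitePi ν)).map (fun x i => φ i (x.1 i, x.2 i)) =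
      Measure.infinitePi fun i => ((μ i).prod (ν i)).map (φ i) := by
  have (i : ι) : IsProbabilityMeasure (((μ i).prod (ν i)).map (φ i)) :=
    Measure.isProbabilityMeasure_map (hφ i).aemeasurable
  refine Measure.eq_infinitePi _ fun s t ht => ?_
  have hm : Measurable fun (x : (∀ i, X i) × (∀ i, Y i)) i => φ i (x.1 i, x.2 i) := by
    refine measurable_pi_lambda _ fun i => (hφ i).comp ?_
    fun_prop
  rw [Measure.map_apply hm (MeasurableSet.pi s.countable_toSet fun i _ => ht i),
    Measure.prod_apply (hm (MeasurableSet.pi s.countable_toSet fun i _ => ht i))]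
  -- The section of a box at fixed `x` is again a box, so its measure is a product of functions of
  -- single coordinates of `x`, which are independent.
  have hsec (x : ∀ i, X i) : Measure.infinitePi ν (Prod.mk x ⁻¹'
      ((fun (x : (∀ i, X i) × (∀ i, Y i)) i => φ i (x.1 i, x.2 i)) ⁻¹' (s : Set ι).pi t)) =
      ∏ i ∈ s, ν i (Prod.mk (x i) ⁻¹' (φ i ⁻¹' t i)) := by
    rw [← Measure.infinitePi_pi (μ := ν)
      (fun i _ => measurable_prodMk_left ((hφ i) (ht i)))]
    rfl
  simp_rw [hsec]
  have hg (i : ι) : Measurable fun a : X i => ν i (Prod.mk a ⁻¹' (φ i ⁻¹' t i)) :=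
    measurable_measure_prodMk_left ((hφ i) (ht i))
  rw [ProbabilityTheory.lintegral_prod_eq_prod_lintegral_of_indepFun s
    (fun i (x : ∀ i, X i) => ν i (Prod.mk (x i) ⁻¹' (φ i ⁻¹' t i)))
    (ProbabilityTheory.iIndepFun_infinitePi
      (X := fun i (a : X i) => ν i (Prod.mk a ⁻¹' (φ i ⁻¹' t i))) hg)
    (fun i => (hg i).comp (measurable_pi_apply i))]
  refine Finset.prod_congr rfl fun i _ => ?_
  rw [Measure.map_apply (hφ i) (ht i), Measure.prod_apply ((hφ i) (ht i)),
    ← Measure.infinitePi_map_eval μ i, lintegral_map (hg i) (measurable_pi_apply i)]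

/-- Resampling an arbitrary set of coordinates preserves a product measure. -/
lemma map_piecewise_infinitePi {X : ι → Type*} [∀ i, MeasurableSpace (X i)]
    (μ : ∀ i, Measure (X i)) [∀ i, IsProbabilityMeasure (μ i)] (B : Set ι)
    [DecidablePred (· ∈ B)] :
    ((Measure.infinitePi μ).prod (Measure.infinitePi μ)).map
      (fun x => B.piecewise x.2 x.1) = Measure.infinitePi μ := by
  have h := map_prod_infinitePi μ μ (fun i x => if i ∈ B then x.2 else x.1) (fun i => by
    split_ifs <;> fun_prop)
  have h2 (i : ι) : ((μ i).prod (μ i)).map (fun x => if i ∈ B then x.2 else x.1) = μ i := by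
    split_ifs
    · exact Measure.map_snd_prod.trans (by simp)
    · exact Measure.map_fst_prod.trans (by simp)
  simp_rw [h2] at h
  exact h

lemma integral_prod_infinitePi {X : ι → Type*} [∀ i, MeasurableSpace (X i)]
    (μ : ∀ i, Measure (X i)) [∀ i, IsProbabilityMeasure (μ i)] (F : Finset ι)
    (φ : ∀ i, X i → ℝ) (hφ : ∀ i, Measurable (φ i)) :
    ∫ x, ∏ i ∈ F, φ i (x i) ∂Measure.infinitePi μ = ∏ i ∈ F, ∫ a, φ i a ∂μ i := by
  have h := (ProbabilityTheory.iIndepFun.precomp (g := ((↑) : F → ι)) Subtype.val_injective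
    (ProbabilityTheory.iIndepFun_infinitePi (P := μ) (X := φ) hφ)).integral_fun_prod_eq_prod_integral
      (fun i => ((hφ i).comp (measurable_pi_apply _)).aestronglyMeasurable)
  have e1 (x : ∀ i, X i) : ∏ i ∈ F, φ i (x i) = ∏ i : F, φ i (x i) :=
    (Finset.prod_coe_sort F fun i => φ i (x i)).symm
  simp_rw [e1]
  rw [h, ← Finset.prod_coe_sort F]
  refine Finset.prod_congr rfl fun i _ => ?_
  rw [← Measure.infinitePi_map_eval μ i,
    integral_map (measurable_pi_apply _).aemeasurable (hφ _).aestronglyMeasurable]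

end ProductMeasures

/-! ### Bernoulli product measures under Boolean operations. -/

section Bernoulli

lemma integral_bernoulli (p : unitInterval) (f : Bool → ℝ) :
    ∫ b, f b ∂bernoulliMeasure true false p = p * f true + (1 - p) * f false := by
  rw [integral_bernoulliMeasure]
  simp

lemma measureReal_bernoulli (p : unitInterval) (A : Set Bool) [DecidablePred (· ∈ A)] :
    (bernoulliMeasure true false p).real A =
      (if true ∈ A then (p : ℝ) else 0) + (if false ∈ A then 1 - (p : ℝ) else 0) := by
  rw [bernoulliMeasure_real_apply p (MeasurableSet.of_discrete)]
  split_ifs <;> simp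

/-- Two probability measures on `Bool` agreeing on `{true}` are equal. -/
lemma ext_bool {μ ν : Measure Bool} [IsProbabilityMeasure μ] [IsProbabilityMeasure ν]
    (h : μ.real {true} = ν.real {true}) : μ = ν := by
  have h1 : μ {true} = ν {true} := (measureReal_eq_measureReal_iff).1 h
  have h2 : μ {false} = ν {false} := by
    have e : ({false} : Set Bool) = {true}ᶜ := by ext b; cases b <;> simp
    rw [e, prob_compl_eq_one_sub (MeasurableSet.of_discrete),
      prob_compl_eq_one_sub (MeasurableSet.of_discrete), h1]
  refine Measure.ext_of_singleton fun b => ?_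
  cases b
  exacts [h2, h1]

instance instIsProbabilityMeasureProdBer (p : unitInterval) :
    IsProbabilityMeasure (prodBer S p) := by
  unfold prodBer; infer_instance

/-- The law of a coordinatewise Boolean function of two independent Bernoulli fields. -/
lemma map_prod_prodBer (p q r : unitInterval) (φ : Bool → Bool → Bool)
    (h : (p : ℝ) * (q * (φ true true).toNat + (1 - q) * (φ true false).toNat) +
      (1 - p) * (q * (φ false true).toNat + (1 - q) * (φ false false).toNat) = r) :
    ((prodBer S p).prod (prodBer S q)).map (fun x s => φ (x.1 s) (x.2 s)) = prodBer S r := by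
  have hφ : Measurable fun x : Bool × Bool => φ x.1 x.2 := measurable_of_countable _
  rw [prodBer, prodBer, map_prod_infinitePi _ _ (fun _ x => φ x.1 x.2) (fun _ => hφ), prodBer]
  congr 1
  funext s
  have := Measure.isProbabilityMeasure_map (μ := (bernoulliMeasure true false p).prod
    (bernoulliMeasure true false q)) hφ.aemeasurable
  refine ext_bool ?_
  rw [measureReal_bernoulli]
  simp only [Set.mem_singleton_iff, if_true, Bool.false_eq_true, if_false, add_zero]
  rw [← h, map_measureReal_apply hφ (MeasurableSet.of_discrete),
    ← integral_indicator_one (MeasurableSet.of_discrete), integral_prod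
      (((fun x : Bool × Bool => φ x.1 x.2) ⁻¹' {true}).indicator 1) (Integrable.of_finite), integral_bernoulli,
    integral_bernoulli, integral_bernoulli]
  cases h1 : φ true true <;> cases h2 : φ true false <;> cases h3 : φ false true <;>
    cases h4 : φ false false <;> simp [h1, h2, h3, h4]

lemma map_and_prodBer (p q r : unitInterval) (h : (p : ℝ) * q = r) :
    ((prodBer S p).prod (prodBer S q)).map (fun x s => x.1 s && x.2 s) = prodBer S r :=
  map_prod_prodBer p q r _ (by simp [h])

lemma map_or_prodBer (p q r : unitInterval) (h : 1 - (1 - (p : ℝ)) * (1 - q) = r) :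
    ((prodBer S p).prod (prodBer S q)).map (fun x s => x.1 s || x.2 s) = prodBer S r :=
  map_prod_prodBer p q r _ (by simp [← h]; ring)

lemma minusNoise_prodBer (p q r : unitInterval) (h : (p : ℝ) * (1 - q) = r) :
    minusNoise (prodBer S p) q = prodBer S r :=
  map_prod_prodBer p q r (fun a b => a && !b) (by simp [← h])

lemma map_not_prodBer (p r : unitInterval) (h : 1 - (p : ℝ) = r) :
    (prodBer S p).map (fun x s => !x s) = prodBer S r := by
  have := map_prod_prodBer (S := S) p p r (fun a _ => !a) (by simp [← h])
  have e : (fun (x : (S → Bool) × (S → Bool)) s => !x.1 s) =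
    (fun (x : S → Bool) s => !x s) ∘ Prod.fst := rfl
  rw [e, ← Measure.map_map (by fun_prop) measurable_fst, Measure.map_fst_prod] at this
  simpa using this

lemma map_piecewise_prodBer (p : unitInterval) (B : Set S) [DecidablePred (· ∈ B)] :
    ((prodBer S p).prod (prodBer S p)).map (fun x => B.piecewise x.2 x.1) = prodBer S p :=
  map_piecewise_infinitePi _ B

lemma map_eval_prodBer (p : unitInterval) (s : S) :
    (prodBer S p).map (fun x => x s) = bernoulliMeasure true false p :=
  Measure.infinitePi_map_eval _ s

lemma integral_eval_prodBer (p : unitInterval) (s : S) (f : Bool → ℝ) :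
    ∫ x, f (x s) ∂prodBer S p = p * f true + (1 - p) * f false := by
  rw [← integral_bernoulli, ← map_eval_prodBer p s,
    integral_map (measurable_pi_apply s).aemeasurable
      (measurable_of_countable f).aestronglyMeasurable]

lemma map_comp_prodBer {T : Type*} (p : unitInterval) (e : T → S) (he : Function.Injective e) :
    (prodBer S p).map (fun x t => x (e t)) = prodBer T p :=
  Measure.map_infinitePi_infinitePi_of_inj he

lemma prodBer_real_false (p : unitInterval) (F : Finset S) :
    (prodBer S p).real {x | ∀ s ∈ F, x s = false} = (1 - p : ℝ) ^ F.card := by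
  have e : {x : S → Bool | ∀ s ∈ F, x s = false} = (F : Set S).pi fun _ => {false} := by
    ext x; simp
  rw [e, measureReal_def, prodBer, Measure.infinitePi_pi _ (fun _ _ => MeasurableSet.of_discrete),
    ENNReal.toReal_prod]
  simp only [← measureReal_def, measureReal_bernoulli]
  simp

lemma prodBer_real_true (p : unitInterval) (F : Finset S) :
    (prodBer S p).real {x | ∀ s ∈ F, x s = true} = (p : ℝ) ^ F.card := by
  have e : {x : S → Bool | ∀ s ∈ F, x s = true} = (F : Set S).pi fun _ => {true} := by
    ext x; simp
  rw [e, measureReal_def, prodBer, Measure.infinitePi_pi _ (fun _ _ => MeasurableSet.of_discrete),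
    ENNReal.toReal_prod]
  simp only [← measureReal_def, measureReal_bernoulli]
  simp

end Bernoulli

/-! ### Noise, couplings and elementary stochastic domination. -/

section Basics

variable [Countable S]

lemma exists_bound {f : (S → Bool) → ℝ} (hf : Continuous f) : ∃ C, ∀ σ, ‖f σ‖ ≤ C := by
  obtain ⟨C, hC⟩ := isCompact_univ.exists_bound_of_continuousOn hf.continuousOn
  exact ⟨C, fun σ => hC σ (Set.mem_univ σ)⟩

lemma integrable_comp {Ω : Type*} [MeasurableSpace Ω] (P : Measure Ω) [IsFiniteMeasure P]
    {f : (S → Bool) → ℝ} (hf : Continuous f) {g : Ω → S → Bool} (hg : Measurable g) :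
    Integrable (fun ω => f (g ω)) P := by
  obtain ⟨C, hC⟩ := exists_bound hf
  exact .of_bound (hf.measurable.comp hg).aestronglyMeasurable C (.of_forall fun ω => hC _)

lemma measurable_plus : Measurable fun (x : (S → Bool) × (S → Bool)) s => x.1 s || x.2 s :=
  measurable_pi_lambda _ fun s =>
    (measurable_of_countable fun y : Bool × Bool => y.1 || y.2).comp
      (f := fun x : (S → Bool) × (S → Bool) => (x.1 s, x.2 s)) (by fun_prop)

lemma measurable_minus : Measurable fun (x : (S → Bool) × (S → Bool)) s => x.1 s && !x.2 s :=
  measurable_pi_lambda _ fun s =>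
    (measurable_of_countable fun y : Bool × Bool => y.1 && !y.2).comp
      (f := fun x : (S → Bool) × (S → Bool) => (x.1 s, x.2 s)) (by fun_prop)

instance instIsProbabilityMeasurePlusNoise (μ : Measure (S → Bool)) [IsProbabilityMeasure μ]
    (ε : unitInterval) : IsProbabilityMeasure (plusNoise μ ε) :=
  Measure.isProbabilityMeasure_map measurable_plus.aemeasurable

instance instIsProbabilityMeasureMinusNoise (μ : Measure (S → Bool)) [IsProbabilityMeasure μ]
    (ε : unitInterval) : IsProbabilityMeasure (minusNoise μ ε) :=
  Measure.isProbabilityMeasure_map measurable_minus.aemeasurable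

lemma integral_plusNoise (μ : Measure (S → Bool)) [IsProbabilityMeasure μ] (ε : unitInterval)
    {f : (S → Bool) → ℝ} (hf : Continuous f) :
    ∫ σ, f σ ∂plusNoise μ ε = ∫ x, ∫ y, f (fun s => x s || y s) ∂prodBer S ε ∂μ := by
  rw [plusNoise, integral_map measurable_plus.aemeasurable hf.measurable.aestronglyMeasurable,
    integral_prod _ (integrable_comp _ hf measurable_plus)]

lemma integral_minusNoise (μ : Measure (S → Bool)) [IsProbabilityMeasure μ] (ε : unitInterval)
    {f : (S → Bool) → ℝ} (hf : Continuous f) :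
    ∫ σ, f σ ∂minusNoise μ ε = ∫ x, ∫ y, f (fun s => x s && !y s) ∂prodBer S ε ∂μ := by
  rw [minusNoise, integral_map measurable_minus.aemeasurable hf.measurable.aestronglyMeasurable,
    integral_prod _ (integrable_comp _ hf measurable_minus)]

lemma StochDom.trans {μ₁ μ₂ μ₃ : Measure (S → Bool)} (h : StochDom μ₁ μ₂) (h' : StochDom μ₂ μ₃) :
    StochDom μ₁ μ₃ := fun f hf hm => (h f hf hm).trans (h' f hf hm)

/-- A pointwise ordered coupling gives stochastic domination. -/
lemma stochDom_map {Ω : Type*} [MeasurableSpace Ω] (P : Measure Ω) [IsFiniteMeasure P]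
    {g h : Ω → S → Bool} (hg : Measurable g) (hh : Measurable h) (hle : ∀ ω, g ω ≤ h ω) :
    StochDom (P.map g) (P.map h) := fun f hf hm => by
  rw [integral_map hg.aemeasurable hf.measurable.aestronglyMeasurable,
    integral_map hh.aemeasurable hf.measurable.aestronglyMeasurable]
  exact integral_mono (integrable_comp P hf hg) (integrable_comp P hf hh) fun ω => hm (hle ω)

lemma minusNoise_stochDom (μ : Measure (S → Bool)) [IsProbabilityMeasure μ] (ε : unitInterval) :
    StochDom (minusNoise μ ε) μ := by
  have h := stochDom_map (μ.prod (prodBer S ε)) measurable_minus measurable_fst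
    (fun x s => by cases h : x.1 s <;> simp)
  rwa [Measure.map_fst_prod, measure_univ, one_smul] at h

lemma prodBer_mono {p q : unitInterval} (h : p ≤ q) : StochDom (prodBer S p) (prodBer S q) := by
  rcases eq_or_lt_of_le (unitInterval.nonneg q) with hq | hq
  · rw [le_antisymm h (Subtype.coe_le_coe.1 (hq.symm.le.trans (unitInterval.nonneg p)))]
    exact fun _ _ _ => le_rfl
  · have h' : (p : ℝ) ≤ q := h
    -- `π_p` is `π_q` thinned with deletion probability `1 - p/q`.
    have e := minusNoise_prodBer (S := S) q
      ⟨1 - p / q, by rw [sub_nonneg]; exact div_le_one_of_le₀ h' hq.le,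
        by have := div_nonneg (unitInterval.nonneg p) hq.le; linarith⟩ p (by
          simp only [sub_sub_cancel]; field_simp)
    rw [← e]
    exact minusNoise_stochDom _ _

lemma zeroProd_stochDom (μ : Measure (S → Bool)) [IsProbabilityMeasure μ] :
    StochDom (prodBer S 0) μ := by
  have h := stochDom_map μ (g := fun _ _ => false) (h := id) measurable_const measurable_id
    (fun ω s => Bool.false_le _)
  rw [Measure.map_id, Measure.map_const, measure_univ, one_smul] at h
  simpa [prodBer, Measure.infinitePi_dirac] using h

/-- The probability that a finite set is vacant is decreasing under stochastic domination. -/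
lemma StochDom.vacant_le {μ ν : Measure (S → Bool)} [IsProbabilityMeasure μ]
    [IsProbabilityMeasure ν] (h : StochDom μ ν) (F : Finset S) :
    ν.real {x | ∀ s ∈ F, x s = false} ≤ μ.real {x | ∀ s ∈ F, x s = false} := by
  have hcl : IsClopen {x : S → Bool | ∀ s ∈ F, x s = false} := by
    have e : {x : S → Bool | ∀ s ∈ F, x s = false} =
        ⋂ s ∈ F, (fun x : S → Bool => x s) ⁻¹' {false} := by ext x; simp
    rw [e]
    exact isClopen_biInter_finset fun s _ => (isClopen_discrete _).preimage (continuous_apply s)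
  set A := {x : S → Bool | ∀ s ∈ F, x s = false}
  have h1 := h (Aᶜ.indicator 1) (hcl.compl.continuous_indicator continuous_one) ?_
  · rw [integral_indicator_one hcl.compl.isOpen.measurableSet,
      integral_indicator_one hcl.compl.isOpen.measurableSet,
      probReal_compl_eq_one_sub hcl.isOpen.measurableSet,
      probReal_compl_eq_one_sub hcl.isOpen.measurableSet] at h1
    linarith
  · intro x y hxy
    by_cases hx : x ∈ Aᶜ
    · have hy : y ∈ Aᶜ := fun hy => hx fun s hs => by
        have := hxy s
        rw [hy s hs] at this
        exact le_antisymm this (Bool.false_le _)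
      simp [Set.indicator_of_mem hx, Set.indicator_of_mem hy]
    · rw [Set.indicator_of_notMem hx]
      exact Set.indicator_nonneg (fun _ _ => zero_le_one) _

end Basics

/-! ### From resampling one block to global domination. -/

section BlockResampling

variable [Countable S] {J : Type*} [Countable J]

lemma measurable_piecewise (B : Set S) [DecidablePred (· ∈ B)] :
    Measurable fun x : (S → Bool) × (S → Bool) => B.piecewise x.1 x.2 := by
  refine measurable_pi_lambda _ fun s => ?_
  by_cases h : s ∈ B
  · simp only [Set.piecewise, h, if_true]; fun_prop
  · simp only [Set.piecewise, h, if_false]; fun_prop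

lemma continuous_piecewise_right (B : Set S) [DecidablePred (· ∈ B)] (η : S → Bool) :
    Continuous fun σ : S → Bool => B.piecewise η σ := by
  refine continuous_pi fun s => ?_
  by_cases h : s ∈ B
  · simp only [Set.piecewise, h, if_true]; fun_prop
  · simp only [Set.piecewise, h, if_false]; fun_prop

lemma continuous_piecewise_left (B : Set S) [DecidablePred (· ∈ B)] (σ : S → Bool) :
    Continuous fun η : S → Bool => B.piecewise η σ := by
  refine continuous_pi fun s => ?_
  by_cases h : s ∈ B
  · simp only [Set.piecewise, h, if_true]; fun_prop
  · simp only [Set.piecewise, h, if_false]; fun_prop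

lemma monotone_piecewise_right (B : Set S) [DecidablePred (· ∈ B)] (η : S → Bool) :
    Monotone fun σ : S → Bool => B.piecewise η σ :=
  fun _ _ h => Set.piecewise_mono (fun _ _ => le_rfl) fun i _ => h i

lemma monotone_piecewise_left (B : Set S) [DecidablePred (· ∈ B)] (σ : S → Bool) :
    Monotone fun η : S → Bool => B.piecewise η σ :=
  fun _ _ h => Set.piecewise_mono (fun i _ => h i) fun _ _ => le_rfl

open Classical in
/-- If resampling any single block of sites from `π_p` decreases the expectations of continuous
increasing functions, then the measure dominates `π_p`. -/
theorem stochDom_of_resample_block (b : S → J) (p : unitInterval) (μ : Measure (S → Bool))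
    [IsProbabilityMeasure μ]
    (H : ∀ (j : J) (f : (S → Bool) → ℝ), Continuous f → Monotone f →
      ∫ σ, ∫ η, f ((b ⁻¹' {j}).piecewise η σ) ∂prodBer S p ∂μ ≤ ∫ σ, f σ ∂μ) :
    StochDom (prodBer S p) μ := by
  intro f hf hm
  have hint (B : Set S) : Integrable
      (fun z : (S → Bool) × (S → Bool) => f (B.piecewise z.1 z.2)) ((prodBer S p).prod μ) :=
    integrable_comp _ hf (measurable_piecewise B)
  -- Hybrid configurations: independent `π_p` values on the blocks in `F`, the `μ`-configuration
  -- elsewhere. Each added block can only lower the expectation.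
  have hF (F : Finset J) :
      ∫ z, f ((b ⁻¹' F).piecewise z.1 z.2) ∂(prodBer S p).prod μ ≤ ∫ σ, f σ ∂μ := by
    induction F using Finset.induction_on with
    | empty =>
      rw [integral_prod _ (hint _)]
      refine le_of_eq ?_
      calc _ = ∫ _ : S → Bool, ∫ σ, f σ ∂μ ∂prodBer S p := by
            refine integral_congr_ae (.of_forall fun η => ?_)
            refine integral_congr_ae (.of_forall fun σ => congrArg f (funext fun s => ?_))
            exact if_neg (by simp)
        _ = _ := by simp
    | insert j F hj ih =>
      have hpw (η η' σ : S → Bool) :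
          (b ⁻¹' (insert j F : Finset J)).piecewise ((b ⁻¹' {j}).piecewise η' η) σ =
            (b ⁻¹' F).piecewise η ((b ⁻¹' {j}).piecewise η' σ) := by
        funext s
        by_cases h1 : b s = j
        · have h2 : b s ∉ F := h1 ▸ hj
          simp [Set.piecewise, h1, hj]
        · simp [Set.piecewise, h1]
      obtain ⟨G, hG⟩ : ∃ G : (S → Bool) → ℝ, ∀ η,
        G η = ∫ σ, f ((b ⁻¹' (insert j F : Finset J)).piecewise η σ) ∂μ := ⟨_, fun _ => rfl⟩
      have hGm : Measurable G := by
        rw [funext hG]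
        exact ((hf.measurable.comp (measurable_piecewise _)).stronglyMeasurable
          |>.integral_prod_right').measurable
      obtain ⟨C, hC⟩ := exists_bound hf
      have hGb (η) : ‖G η‖ ≤ C := by
        rw [hG]
        refine (norm_integral_le_of_norm_le_const (.of_forall fun σ => hC _)).trans ?_
        simp
      have hpm : Measurable fun x : (S → Bool) × (S → Bool) => (b ⁻¹' {j}).piecewise x.2 x.1 :=
        (measurable_piecewise (b ⁻¹' {j})).comp measurable_swap
      have hGi : Integrable (fun x : (S → Bool) × (S → Bool) => G ((b ⁻¹' {j}).piecewise x.2 x.1))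
          ((prodBer S p).prod (prodBer S p)) :=
        .of_bound (hGm.comp hpm).aestronglyMeasurable C (.of_forall fun x => hGb _)
      have hstep (η : S → Bool) : ∫ η', G ((b ⁻¹' {j}).piecewise η' η) ∂prodBer S p ≤
          ∫ σ, f ((b ⁻¹' F).piecewise η σ) ∂μ := by
        simp_rw [hG, hpw]
        rw [integral_integral_swap]
        · exact H j (fun σ => f ((b ⁻¹' F).piecewise η σ))
            (hf.comp (continuous_piecewise_right _ η)) (hm.comp (monotone_piecewise_right _ η))
        · exact integrable_comp _ (hf.comp (continuous_piecewise_right (b ⁻¹' F) η))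
            (measurable_piecewise (b ⁻¹' {j}))
      refine le_trans ?_ ih
      rw [integral_prod _ (hint _), integral_prod _ (hint _)]
      simp_rw [← hG]
      -- Giving block `j` of `η` its own independent copy `η'` does not change the law. By `hpw`
      -- this copy can be viewed as resampling block `j` of `σ`, so `H` applies for each fixed `η`.
      conv_lhs => rw [← map_piecewise_prodBer p (b ⁻¹' {j})]
      rw [integral_map hpm.aemeasurable hGm.aestronglyMeasurable, integral_prod _ hGi]
      exact integral_mono hGi.integral_prod_left (hint _).integral_prod_left hstep
  have hlim : Filter.Tendsto (fun F : Finset J =>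
      ∫ z, f ((b ⁻¹' F).piecewise z.1 z.2) ∂(prodBer S p).prod μ) Filter.atTop
      (nhds (∫ z, f z.1 ∂(prodBer S p).prod μ)) := by
    obtain ⟨C, hC⟩ := exists_bound hf
    refine tendsto_integral_filter_of_dominated_convergence (fun _ => C)
      (.of_forall fun F => (hint _).aestronglyMeasurable)
      (.of_forall fun F => .of_forall fun z => hC _) (integrable_const C) (.of_forall fun z => ?_)
    refine (hf.tendsto _).comp (tendsto_pi_nhds.2 fun s => ?_)
    refine tendsto_nhds_of_eventually_eq ?_
    filter_upwards [Filter.eventually_ge_atTop {b s}] with F hF'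
    have : b s ∈ F := hF' (Finset.mem_singleton_self _)
    simp [Set.piecewise, this]
  have := le_of_tendsto' hlim hF
  rwa [integral_fun_fst, probReal_univ, one_smul] at this

end BlockResampling

/-! ### Insertion tolerance in terms of events and integrals. -/

section InsertionTolerance

lemma measurableSet_site (s : S) : MeasurableSet {τ : S → Bool | τ s = true} :=
  measurableSet_eq_fun (measurable_pi_apply s) measurable_const

/-- Membership in a cylinder event on `Δ` depends only on the coordinates in `Δ`. -/
lemma mem_iff_of_cylinderEvents {Δ : Set S} {A : Set (S → Bool)}
    (hA : MeasurableSet[cylinderEvents Δ] A) {σ τ : S → Bool} (h : ∀ s ∈ Δ, σ s = τ s) :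
    σ ∈ A ↔ τ ∈ A := by
  -- The map choosing between `σ` and `τ` is constant on each coordinate in `Δ`, hence measurable
  -- even from the trivial σ-algebra; so the preimage of `A` is empty or everything.
  have hg : @Measurable Bool (S → Bool) ⊥ (cylinderEvents Δ) fun b => if b then σ else τ := by
    refine (@measurable_cylinderEvents_iff _ _ _ ⊥ _ _ _).2 fun s hs => ?_
    have : (fun b : Bool => (if b then σ else τ) s) = fun _ => τ s := by
      funext b; cases b <;> simp [h s hs]
    rw [this]
    exact @measurable_const _ _ _ ⊥ _
  have := hg hA
  rw [MeasurableSpace.measurableSet_bot_iff] at this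
  have h1 : (true ∈ (fun b : Bool => if b then σ else τ) ⁻¹' A) ↔
      (false ∈ (fun b : Bool => if b then σ else τ) ⁻¹' A) := by
    rcases this with h | h <;> rw [h] <;> simp
  simpa using h1

/-- A coordinate is independent of the events not depending on it. -/
lemma infinitePi_inter_eval {ι : Type*} {X : ι → Type*} [∀ i, MeasurableSpace (X i)]
    (μ : ∀ i, Measure (X i)) [∀ i, IsProbabilityMeasure (μ i)] (i : ι) {B : Set (∀ i, X i)}
    (hB : MeasurableSet B) (hinv : ∀ x y : ∀ i, X i, (∀ j ≠ i, x j = y j) → (x ∈ B ↔ y ∈ B))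
    {C : Set (X i)} (hC : MeasurableSet C) :
    Measure.infinitePi μ (B ∩ {x | x i ∈ C}) = Measure.infinitePi μ B * μ i C := by
  classical
  have hm : Measurable fun x : (∀ i, X i) × (∀ i, X i) =>
      (({i} : Set ι).piecewise x.2 x.1 : ∀ i, X i) := by
    refine measurable_pi_lambda _ fun j => ?_
    by_cases h : j ∈ ({i} : Set ι)
    · simp only [Set.piecewise, h, if_true]; fun_prop
    · simp only [Set.piecewise, h, if_false]; fun_prop
  have hC' : MeasurableSet {x : ∀ i, X i | x i ∈ C} := measurable_pi_apply i hC
  -- After resampling coordinate `i` from a second copy, the two events live on different factors.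
  conv_lhs => rw [← map_piecewise_infinitePi μ {i}]
  rw [Measure.map_apply hm (hB.inter hC')]
  have e : (fun x : (∀ i, X i) × (∀ i, X i) => (({i} : Set ι).piecewise x.2 x.1 : ∀ i, X i)) ⁻¹'
      (B ∩ {x | x i ∈ C}) = B ×ˢ {x | x i ∈ C} := by
    ext ⟨x, y⟩
    simp only [Set.mem_preimage, Set.mem_inter_iff, Set.mem_prod, Set.mem_ofPred_eq]
    refine and_congr (hinv _ _ fun j hj => ?_) ?_
    · simp [Set.piecewise, hj]
    · simp [Set.piecewise]
  rw [e, Measure.prod_prod, ← Measure.infinitePi_map_eval μ i,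
    Measure.map_apply (measurable_pi_apply i) hC]
  rfl

lemma insertionTolerant_of_measure (μ : Measure (S → Bool)) [IsProbabilityMeasure μ] {ε : ℝ}
    (h : ∀ (s : S) (A : Set (S → Bool)), MeasurableSet[cylinderEvents ({s}ᶜ : Set S)] A →
      ε * μ.real A ≤ μ.real (A ∩ {τ | τ s = true})) : InsertionTolerant μ ε := by
  intro s
  have hm : cylinderEvents (X := fun _ : S => Bool) ({s}ᶜ : Set S) ≤ MeasurableSpace.pi :=
    cylinderEvents_le_pi
  have hms : MeasurableSet {τ : S → Bool | τ s = true} :=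
    measurableSet_site s
  have hi : Integrable ({τ : S → Bool | τ s = true}.indicator fun _ => (1 : ℝ)) μ :=
    (integrable_const _).indicator hms
  refine ae_of_ae_trim hm (ae_le_of_forall_setIntegral_le (integrable_const ε)
    (integrable_condExp.trim hm stronglyMeasurable_condExp) fun A hA _ => ?_)
  rw [← setIntegral_trim hm stronglyMeasurable_const hA,
    ← setIntegral_trim hm stronglyMeasurable_condExp hA, setIntegral_condExp hm hi hA,
    setIntegral_indicator hms, setIntegral_const, setIntegral_const]
  simpa [mul_comm] using h s A hA

/-- Since `D` does not look at `s`, it can be pulled out of the conditional expectation. This is the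
form used with increments of increasing functions. -/
lemma InsertionTolerant.integral_le {μ : Measure (S → Bool)} [IsProbabilityMeasure μ] {ε : ℝ}
    (h : InsertionTolerant μ ε) (s : S) {D : (S → Bool) → ℝ}
    (hD : StronglyMeasurable[cylinderEvents ({s}ᶜ : Set S)] D) (hDi : Integrable D μ)
    (h0 : 0 ≤ D) : ε * ∫ σ, D σ ∂μ ≤
      ∫ σ, D σ * {τ : S → Bool | τ s = true}.indicator (fun _ => (1 : ℝ)) σ ∂μ := by
  have hm : cylinderEvents (X := fun _ : S => Bool) ({s}ᶜ : Set S) ≤ MeasurableSpace.pi :=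
    cylinderEvents_le_pi
  have hms : MeasurableSet {τ : S → Bool | τ s = true} :=
    measurableSet_site s
  have hi : Integrable ({τ : S → Bool | τ s = true}.indicator fun _ => (1 : ℝ)) μ :=
    (integrable_const _).indicator hms
  have hDi' : Integrable (D * {τ : S → Bool | τ s = true}.indicator fun _ => (1 : ℝ)) μ := by
    have e : (D * {τ : S → Bool | τ s = true}.indicator fun _ => (1 : ℝ)) =
        {τ : S → Bool | τ s = true}.indicator D := by
      funext σ
      by_cases hσ : σ ∈ {τ : S → Bool | τ s = true} <;> simp [hσ]
    rw [e]
    exact hDi.indicator hms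
  have hpull := condExp_mul_of_stronglyMeasurable_left hD hDi' hi
  have e : ∫ σ, D σ * {τ : S → Bool | τ s = true}.indicator (fun _ => (1 : ℝ)) σ ∂μ =
      ∫ σ, D σ * (μ⟦{τ : S → Bool | τ s = true} | cylinderEvents ({s}ᶜ : Set S)⟧) σ ∂μ := by
    exact (integral_condExp hm).symm.trans (integral_congr_ae hpull)
  rw [e, ← integral_const_mul]
  refine integral_mono_ae (hDi.const_mul ε) (integrable_condExp.congr hpull) ?_
  filter_upwards [h s] with σ hσ
  rw [mul_comm]
  exact mul_le_mul_of_nonneg_left hσ (h0 σ)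

lemma InsertionTolerant.measure_le {μ : Measure (S → Bool)} [IsProbabilityMeasure μ] {ε : ℝ}
    (h : InsertionTolerant μ ε) (s : S) {A : Set (S → Bool)}
    (hA : MeasurableSet[cylinderEvents ({s}ᶜ : Set S)] A) :
    ε * μ.real A ≤ μ.real (A ∩ {τ | τ s = true}) := by
  have hm : cylinderEvents (X := fun _ : S => Bool) ({s}ᶜ : Set S) ≤ MeasurableSpace.pi :=
    cylinderEvents_le_pi
  have hms : MeasurableSet {τ : S → Bool | τ s = true} :=
    measurableSet_site s
  have := h.integral_le s (D := A.indicator fun _ => 1) (stronglyMeasurable_const.indicator hA)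
    ((integrable_const 1).indicator (hm _ hA)) (Set.indicator_nonneg fun _ _ => zero_le_one)
  have e : (fun σ => A.indicator (fun _ => (1 : ℝ)) σ *
      {τ : S → Bool | τ s = true}.indicator (fun _ => (1 : ℝ)) σ) =
      (A ∩ {τ | τ s = true}).indicator 1 := by
    rw [Set.inter_indicator_one]; rfl
  rw [e, integral_indicator_one ((hm _ hA).inter hms)] at this
  have e' : (A.indicator fun _ : S → Bool => (1 : ℝ)) = A.indicator 1 := rfl
  rwa [e', integral_indicator_one (hm _ hA)] at this

lemma measurable_update_cylinderEvents [DecidableEq S] (s : S) (c : Bool) :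
    Measurable[cylinderEvents ({s}ᶜ : Set S)] fun σ : S → Bool => Function.update σ s c := by
  refine @measurable_pi_lambda _ _ _ (_) _ _ fun t => ?_
  by_cases ht : t = s
  · subst ht
    simp only [Function.update_self]
    exact @measurable_const _ _ _ (_) _
  · simp only [Function.update_of_ne ht]
    exact measurable_cylinderEvent_apply ht

end InsertionTolerance

/-! ### The four implications. -/

section Implications

variable [Countable S]

/-- Split `f` into its value with `s` vacant plus the increment `D ≥ 0` on `σ s = true`. Resampling
`s` replaces the indicator by `p`, and insertion tolerance bounds `p ∫ D` by the original increment
term. -/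
theorem InsertionTolerant.stochDom {μ : Measure (S → Bool)} [IsProbabilityMeasure μ]
    {p : unitInterval} (h : InsertionTolerant μ p) : StochDom (prodBer S p) μ := by
  classical
  refine stochDom_of_resample_block id p μ fun s f hf hm => ?_
  have hup (c : Bool) : Continuous fun σ : S → Bool => f (Function.update σ s c) :=
    hf.comp (continuous_id.update s continuous_const)
  have hi (c : Bool) : Integrable (fun σ : S → Bool => f (Function.update σ s c)) μ :=
    integrable_comp μ (hup c) measurable_id
  have hcyl (c : Bool) : StronglyMeasurable[cylinderEvents ({s}ᶜ : Set S)]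
      fun σ : S → Bool => f (Function.update σ s c) :=
    (hf.measurable.comp (measurable_update_cylinderEvents s c)).stronglyMeasurable
  have key := h.integral_le s (D := fun σ => f (Function.update σ s true) -
    f (Function.update σ s false)) ((hcyl true).sub (hcyl false)) ((hi true).sub (hi false))
    (fun σ => sub_nonneg.2 (hm (Function.update_mono (Bool.false_le _))))
  have e1 (σ : S → Bool) : ∫ η, f ((id ⁻¹' {s}).piecewise η σ) ∂prodBer S p =
      p * (f (Function.update σ s true) - f (Function.update σ s false)) +
        f (Function.update σ s false) := by
    have (η : S → Bool) : (id ⁻¹' {s}).piecewise η σ = Function.update σ s (η s) := by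
      funext t
      by_cases ht : t = s
      · subst ht; simp [Set.piecewise]
      · simp [Set.piecewise, ht]
    simp_rw [this]
    rw [integral_eval_prodBer p s (fun c => f (Function.update σ s c))]
    ring
  have e2 (σ : S → Bool) : f σ = (f (Function.update σ s true) - f (Function.update σ s false)) *
      {τ : S → Bool | τ s = true}.indicator (fun _ => (1 : ℝ)) σ +
        f (Function.update σ s false) := by
    by_cases hσ : σ s = true
    · have : Function.update σ s true = σ := by rw [← hσ, Function.update_eq_self]
      simp [hσ, this]
    · have : Function.update σ s false = σ := by
        rw [← Bool.eq_false_iff.2 hσ, Function.update_eq_self]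
      simp [hσ, this]
  have hind : Integrable (fun σ : S → Bool => (f (Function.update σ s true) -
      f (Function.update σ s false)) *
      {τ : S → Bool | τ s = true}.indicator (fun _ => (1 : ℝ)) σ) μ := by
    have := (integrable_comp μ hf measurable_id).sub (hi false)
    refine this.congr (.of_forall fun σ => ?_)
    simp only [Pi.sub_apply, id]
    rw [sub_eq_iff_eq_add]
    exact e2 σ
  calc _ = ∫ σ, (p * (f (Function.update σ s true) - f (Function.update σ s false)) +
        f (Function.update σ s false)) ∂μ := integral_congr_ae (.of_forall e1)
    _ = p * ∫ σ, (f (Function.update σ s true) - f (Function.update σ s false)) ∂μ +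
        ∫ σ, f (Function.update σ s false) ∂μ := by
      have := integral_add (((hi true).sub (hi false)).const_mul p) (hi false)
      rw [integral_const_mul] at this
      exact this
    _ ≤ _ := add_le_add_left key _
    _ = ∫ σ, f σ ∂μ := by
      rw [← integral_add hind (hi false)]
      exact integral_congr_ae (.of_forall fun σ => (e2 σ).symm)

theorem UniformlyInsertionTolerant.dominatesProduct {μ : Measure (S → Bool)}
    [IsProbabilityMeasure μ] (h : UniformlyInsertionTolerant μ) : DominatesProduct μ := by
  obtain ⟨ε, h0, h⟩ := h
  -- The tolerance is an arbitrary positive real and is cut off at `1` to become a parameter.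
  refine ⟨⟨min ε 1, by positivity, min_le_right _ _⟩, Subtype.coe_lt_coe.1 (by simpa using h0), ?_⟩
  refine InsertionTolerant.stochDom fun s => ?_
  filter_upwards [h s] with σ hσ
  exact (min_le_left _ _).trans hσ

/-- For an event `A` not depending on `s`, the noise bit at `s` is independent of whether the noisy
configuration lies in `A`; when it is set, which has probability `ε`, the site `s` is occupied. -/
theorem plusNoise_insertionTolerant (ν : Measure (S → Bool)) [IsProbabilityMeasure ν]
    (ε : unitInterval) : InsertionTolerant (plusNoise ν ε) ε := by
  classical
  refine insertionTolerant_of_measure _ fun s A hA => ?_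
  have hA' : MeasurableSet A := cylinderEvents_le_pi _ hA
  have hB : MeasurableSet {z : (S → Bool) × (S → Bool) | (fun t => z.1 t || z.2 t) ∈ A} :=
    measurable_plus hA'
  have hs : MeasurableSet {z : (S → Bool) × (S → Bool) | z.2 s = true} :=
    measurable_snd (measurableSet_site s)
  have key : (ν.prod (prodBer S ε)) ({z | (fun t => z.1 t || z.2 t) ∈ A} ∩ {z | z.2 s = true}) =
      (ν.prod (prodBer S ε)) {z | (fun t => z.1 t || z.2 t) ∈ A} *
        bernoulliMeasure true false ε {true} := by
    rw [Measure.prod_apply (hB.inter hs), Measure.prod_apply hB,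
      ← lintegral_mul_const _ (measurable_measure_prodMk_left hB)]
    refine lintegral_congr fun x => ?_
    exact infinitePi_inter_eval (fun _ : S => bernoulliMeasure true false ε) s
      (measurable_prodMk_left hB) (fun y y' h => mem_iff_of_cylinderEvents hA fun t ht =>
        congrArg (x t || ·) (h t ht)) (C := {true}) (MeasurableSet.of_discrete)
  have key' := congrArg ENNReal.toReal key
  rw [ENNReal.toReal_mul] at key'
  simp only [← measureReal_def, measureReal_bernoulli] at key'
  simp only [Set.mem_singleton_iff, if_true, Bool.false_eq_true, if_false, add_zero] at key'
  rw [plusNoise, map_measureReal_apply measurable_plus hA',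
    map_measureReal_apply measurable_plus (hA'.inter (measurableSet_site s)), mul_comm]
  refine key'.symm.le.trans (measureReal_mono fun z hz => ⟨hz.1, ?_⟩)
  have : z.2 s = true := hz.2
  simp [this]

theorem UniformlyUpwardsExtractable.uniformlyInsertionTolerant {μ : Measure (S → Bool)}
    (h : UniformlyUpwardsExtractable μ) : UniformlyInsertionTolerant μ := by
  obtain ⟨ε, h0, -, ν, hν, rfl⟩ := h
  exact ⟨ε, h0, plusNoise_insertionTolerant ν ε⟩

lemma continuous_integral_plus {f : (S → Bool) → ℝ} (hf : Continuous f) (ε : unitInterval) :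
    Continuous fun x : S → Bool => ∫ y, f (fun s => x s || y s) ∂prodBer S ε := by
  obtain ⟨C, hC⟩ := exists_bound hf
  refine continuous_of_dominated (bound := fun _ => C) (fun x => ?_)
    (fun x => .of_forall fun y => hC _) (integrable_const C) (.of_forall fun y => ?_)
  · exact (integrable_comp _ hf
      (measurable_plus.comp measurable_prodMk_left)).aestronglyMeasurable
  · refine hf.comp (continuous_pi fun s => ?_)
    exact (continuous_of_discreteTopology (f := fun b => b || y s)).comp (continuous_apply s)

lemma continuous_integral_minus {f : (S → Bool) → ℝ} (hf : Continuous f) (ε : unitInterval) :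
    Continuous fun x : S → Bool => ∫ y, f (fun s => x s && !y s) ∂prodBer S ε := by
  obtain ⟨C, hC⟩ := exists_bound hf
  refine continuous_of_dominated (bound := fun _ => C) (fun x => ?_)
    (fun x => .of_forall fun y => hC _) (integrable_const C) (.of_forall fun y => ?_)
  · exact (integrable_comp _ hf
      (measurable_minus.comp measurable_prodMk_left)).aestronglyMeasurable
  · refine hf.comp (continuous_pi fun s => ?_)
    exact (continuous_of_discreteTopology (f := fun b => b && !y s)).comp (continuous_apply s)

lemma monotone_integral_plus {f : (S → Bool) → ℝ} (hf : Continuous f) (hm : Monotone f)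
    (ε : unitInterval) : Monotone fun x : S → Bool => ∫ y, f (fun s => x s || y s) ∂prodBer S ε :=
  fun _ _ h => integral_mono
    (integrable_comp _ hf (measurable_plus.comp measurable_prodMk_left))
    (integrable_comp _ hf (measurable_plus.comp measurable_prodMk_left))
    fun y => hm fun s => sup_le_sup_right (h s) (y s)

lemma StochDom.plusNoise {μ ν : Measure (S → Bool)} [IsProbabilityMeasure μ]
    [IsProbabilityMeasure ν] (h : StochDom μ ν) (ε : unitInterval) :
    StochDom (plusNoise μ ε) (plusNoise ν ε) := fun f hf hm => by
  rw [integral_plusNoise _ _ hf, integral_plusNoise _ _ hf]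
  exact h _ (continuous_integral_plus hf ε) (monotone_integral_plus hf hm ε)

/-- A slight additional plus noise does not undo a minus noise applied to an upwards extractable
measure. -/
lemma plusNoise_minusNoise_plusNoise_stochDom (ν : Measure (S → Bool)) [IsProbabilityMeasure ν]
    (ε δ c : unitInterval) (hc : 1 - (1 - (ε : ℝ) * (1 - δ)) * (1 - c) = ε) :
    StochDom (Domination.plusNoise (minusNoise (Domination.plusNoise ν ε) δ) c)
      (Domination.plusNoise ν ε) := by
  intro f hf hm
  have h1 := continuous_integral_plus hf c
  have h2 := continuous_integral_minus h1 δ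
  -- `c` is chosen so that thinning by `δ` followed by adding `c` preserves `π_ε`.
  have hlaw : Domination.plusNoise (minusNoise (prodBer S ε) δ) c = prodBer S ε := by
    have h0 : 0 ≤ (ε : ℝ) * (1 - δ) := mul_nonneg ε.2.1 (sub_nonneg.2 δ.2.2)
    have h1 : (ε : ℝ) * (1 - δ) ≤ 1 :=
      mul_le_one₀ ε.2.2 (sub_nonneg.2 δ.2.2) (by linarith [δ.2.1])
    rw [minusNoise_prodBer ε δ ⟨_, h0, h1⟩ rfl]
    exact map_or_prodBer _ _ _ hc
  rw [integral_plusNoise _ _ hf, integral_minusNoise _ _ h1, integral_plusNoise _ _ h2,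
    integral_plusNoise _ _ hf]
  refine integral_mono (integrable_comp ν (continuous_integral_plus h2 ε) measurable_id)
    (integrable_comp ν (continuous_integral_plus hf ε) measurable_id) fun x => ?_
  have hg : Continuous fun y : S → Bool => f fun s => x s || y s := by
    refine hf.comp (continuous_pi fun s => ?_)
    exact (continuous_of_discreteTopology (f := fun b => x s || b)).comp (continuous_apply s)
  have h3 := continuous_integral_plus hg c
  have h4 := continuous_integral_minus h3 δ
  have e : ∫ y, f (fun s => x s || y s) ∂prodBer S ε =
      ∫ y, ∫ ξ, ∫ z, f (fun s => x s || ((y s && !ξ s) || z s)) ∂prodBer S c ∂prodBer S δ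
        ∂prodBer S ε := by
    conv_lhs => rw [← hlaw]
    rw [integral_plusNoise _ _ hg, integral_minusNoise _ _ h3]
  simp only
  rw [e]
  refine integral_mono (integrable_comp _ h2 (measurable_plus.comp measurable_prodMk_left))
    (integrable_comp _ h4 measurable_id) fun y => ?_
  refine integral_mono (integrable_comp _ h1 (measurable_minus.comp measurable_prodMk_left))
    (integrable_comp _ h3 (measurable_minus.comp measurable_prodMk_left)) fun ξ => ?_
  refine integral_mono (integrable_comp _ hf (measurable_plus.comp measurable_prodMk_left))
    (integrable_comp _ hg (measurable_plus.comp measurable_prodMk_left)) fun z => ?_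
  -- The coupling: deleting from `x ∨ y` leaves no more than deleting from the noise `y` only.
  refine hm fun s => ?_
  simp only
  cases x s <;> cases y s <;> cases ξ s <;> cases z s <;> simp

/-- Plus noise of rate `c` turns `π_{p_max} ⪯ μ^{(-,δ)}` into `π_r ⪯ μ`, with `r > p_max` because
`p_max < 1`. -/
theorem UniformlyUpwardsExtractable.rigid [Nonempty S] {μ : Measure (S → Bool)}
    (h : UniformlyUpwardsExtractable μ) : Rigid μ := by
  obtain ⟨ε, hε0, hε1, ν, hν, rfl⟩ := h
  rintro ⟨-, δ, hδ0, hδ1, hd⟩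
  set μ := plusNoise ν ε
  have hε0' : (0 : ℝ) < ε := hε0
  have hε1' : (ε : ℝ) < 1 := hε1
  have hδ0' : (0 : ℝ) < δ := hδ0
  have hδ1' : (δ : ℝ) < 1 := hδ1
  -- Under `μ^{(-,δ)}` every site is vacant with probability at least `δ`.
  have hp1 : (pMax μ : ℝ) < 1 := by
    obtain ⟨s⟩ := ‹Nonempty S›
    have h1 := hd.vacant_le {s}
    rw [prodBer_real_false] at h1
    have h3 : (δ : ℝ) ≤ (minusNoise μ δ).real {x | ∀ t ∈ ({s} : Finset S), x t = false} := by
      have hA : MeasurableSet {x : S → Bool | ∀ t ∈ ({s} : Finset S), x t = false} := by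
        simpa using (measurableSet_eq_fun (measurable_pi_apply s) measurable_const)
      rw [minusNoise, map_measureReal_apply measurable_minus hA]
      calc (δ : ℝ) = (μ.prod (prodBer S δ)).real
            (Set.univ ×ˢ {x | ∀ t ∈ ({s} : Finset S), x t = true}) := by
            rw [measureReal_prod_prod, prodBer_real_true]; simp
        _ ≤ _ := by
            refine measureReal_mono fun z hz => ?_
            intro t ht
            have := hz.2 t ht
            simp [this]
    simp only [Finset.card_singleton, pow_one] at h1
    linarith
  have hden : 0 < 1 - (ε : ℝ) + ε * δ := by nlinarith
  -- This rate solves `(1 - ε(1-δ))(1-c) = 1-ε`.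
  have hc0 : 0 < (ε : ℝ) * δ / (1 - ε + ε * δ) := by positivity
  have hc1 : (ε : ℝ) * δ / (1 - ε + ε * δ) ≤ 1 := (div_le_one hden).2 (by linarith)
  set c : unitInterval := ⟨_, hc0.le, hc1⟩ with hc
  have hr0 : 0 ≤ 1 - (1 - (pMax μ : ℝ)) * (1 - c) := by
    have := mul_le_one₀ (a := 1 - (pMax μ : ℝ)) (by linarith [(pMax μ).2.1])
      (sub_nonneg.2 c.2.2) (by linarith [c.2.1])
    linarith
  have hr1 : 1 - (1 - (pMax μ : ℝ)) * (1 - c) ≤ 1 := by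
    have := mul_nonneg (sub_nonneg.2 hp1.le) (sub_nonneg.2 c.2.2)
    linarith
  set r : unitInterval := ⟨_, hr0, hr1⟩ with hr
  have hdom : StochDom (prodBer S r) μ := by
    have h1 := hd.plusNoise c
    have h2 : plusNoise (prodBer S (pMax μ)) c = prodBer S r := map_or_prodBer _ _ _ rfl
    rw [h2] at h1
    refine h1.trans (plusNoise_minusNoise_plusNoise_stochDom ν ε δ c ?_)
    simp only [hc]
    field_simp
    ring
  have hle : r ≤ pMax μ := le_sSup hdom
  have hle' : 1 - (1 - (pMax μ : ℝ)) * (1 - c) ≤ pMax μ := hle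
  have : 0 < (1 - (pMax μ : ℝ)) * c := mul_pos (by linarith) hc0
  nlinarith

theorem Rigid.dominatesProduct {μ : Measure (S → Bool)} [IsProbabilityMeasure μ]
    (h : Rigid μ) : DominatesProduct μ := by
  by_contra hd
  have h0 : pMax μ = 0 := by
    refine le_antisymm (sSup_le fun p hp => ?_) (unitInterval.nonneg _)
    by_contra hp0
    exact hd ⟨p, not_le.1 hp0, hp⟩
  refine h ⟨h0 ▸ zeroProd_stochDom μ, ⟨1 / 2, by norm_num, by norm_num⟩, ?_, ?_, ?_⟩
  · exact Subtype.coe_lt_coe.1 (by norm_num)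
  · exact Subtype.coe_lt_coe.1 (by norm_num)
  · exact h0 ▸ zeroProd_stochDom _

end Implications

/-! ### Translation invariance. -/

section Translations

lemma measurable_shift (k : ℤ) : Measurable fun (σ : ℤ → Bool) (i : ℤ) => σ (i + k) :=
  measurable_pi_lambda _ fun i => measurable_pi_apply (i + k)

lemma translationInvariant_of_shift_one {μ : Measure (ℤ → Bool)}
    (h : μ.map (fun (σ : ℤ → Bool) (i : ℤ) => σ (i + 1)) = μ) : TranslationInvariant μ := by
  have hcomp (k l : ℤ) : (μ.map fun (σ : ℤ → Bool) (i : ℤ) => σ (i + k)).map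
      (fun (σ : ℤ → Bool) (i : ℤ) => σ (i + l)) = μ.map fun σ i => σ (i + (k + l)) := by
    rw [Measure.map_map (measurable_shift l) (measurable_shift k)]
    congr 1
    funext σ i
    simp only [Function.comp_apply]
    congr 1
    ring
  intro k
  induction k using Int.induction_on with
  | zero => simp
  | succ k ih => rw [add_comm, ← hcomp, h, ih]
  | pred k ih =>
    conv_lhs => rw [← h]
    rw [hcomp, add_sub_cancel, ih]

lemma map_shift_prodBer (p : unitInterval) (k : ℤ) :
    (prodBer ℤ p).map (fun (σ : ℤ → Bool) (i : ℤ) => σ (i + k)) = prodBer ℤ p :=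
  map_comp_prodBer p (· + k) (add_left_injective k)

end Translations

/-- Comparison of exponential rates along arbitrarily large exponents. -/
lemma le_of_frequently_mul_pow_le {c x y : ℝ} (hc : 0 < c) (hy : 0 ≤ y)
    (h : ∀ N : ℕ, ∃ M ≥ N, c * x ^ M ≤ y ^ M) : x ≤ y := by
  by_contra! hxy
  rcases hy.eq_or_lt with rfl | hy
  · obtain ⟨M, hM, h⟩ := h 1
    rw [zero_pow (by omega)] at h
    have := mul_pos hc (pow_pos hxy M)
    linarith
  · have h1 : 1 < x / y := (one_lt_div hy).2 hxy
    obtain ⟨N, hN⟩ := pow_unbounded_of_one_lt (1 / c) h1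
    obtain ⟨M, hM, h⟩ := h N
    have h2 : 1 / c < (x / y) ^ M := hN.trans_le (pow_le_pow_right₀ h1.le hM)
    rw [div_pow, div_lt_div_iff₀ hc (pow_pos hy M)] at h2
    linarith

/-- The parameter `1/2`. -/
noncomputable def half : unitInterval := ⟨1 / 2, by norm_num, by norm_num⟩

lemma coe_half : (half : ℝ) = 1 / 2 := rfl

lemma half_param_pos : 0 < half := Subtype.coe_lt_coe.1 (by norm_num [coe_half])

lemma half_param_lt_one : half < 1 := Subtype.coe_lt_coe.1 (by norm_num [coe_half])

lemma minusNoise_map [Countable S] {Ω : Type*} [MeasurableSpace Ω] (P : Measure Ω)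
    [IsProbabilityMeasure P] {g : Ω → S → Bool} (hg : Measurable g) (ε : unitInterval) :
    minusNoise (P.map g) ε = (P.prod (prodBer S ε)).map fun z s => g z.1 s && !z.2 s := by
  have h := Measure.map_prod_map P (prodBer S ε) hg measurable_id
  rw [Measure.map_id] at h
  rw [minusNoise, h, Measure.map_map measurable_minus (hg.prodMap measurable_id)]
  rfl

lemma measurableSet_vacant (F : Finset S) :
    MeasurableSet {x : S → Bool | ∀ s ∈ F, x s = false} := by
  have e : {x : S → Bool | ∀ s ∈ F, x s = false} = (F : Set S).pi fun _ => {false} := by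
    ext x; simp
  rw [e]
  exact MeasurableSet.pi F.countable_toSet fun _ _ => MeasurableSet.of_discrete

/-! ### A rigid measure that is not uniformly insertion tolerant. -/

section NeighbourMaximum

/-- Replace each value of a configuration on `ℤ` by the maximum of itself and its right
neighbour. -/
def neighbourMax (u : ℤ → Bool) (i : ℤ) : Bool := u i || u (i + 1)

lemma measurable_neighbourMax : Measurable neighbourMax :=
  measurable_pi_lambda _ fun i =>
    (measurable_of_countable fun y : Bool × Bool => y.1 || y.2).comp
      (f := fun x : ℤ → Bool => (x i, x (i + 1))) (by fun_prop)

/-- The law of the maxima of neighbouring pairs of independent fair bits. -/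
noncomputable def neighbourMaxLaw : Measure (ℤ → Bool) := (prodBer ℤ half).map neighbourMax

instance instIsProbabilityMeasureNeighbourMaxLaw : IsProbabilityMeasure neighbourMaxLaw :=
  Measure.isProbabilityMeasure_map measurable_neighbourMax.aemeasurable

lemma neighbourMaxLaw_translationInvariant : TranslationInvariant neighbourMaxLaw := by
  refine translationInvariant_of_shift_one ?_
  rw [neighbourMaxLaw, Measure.map_map (measurable_shift 1) measurable_neighbourMax]
  conv_rhs => rw [← map_shift_prodBer half 1, Measure.map_map measurable_neighbourMax
    (measurable_shift 1)]
  rfl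

lemma neighbourMaxLaw_stochDom : StochDom (prodBer ℤ half) neighbourMaxLaw := by
  have := stochDom_map (prodBer ℤ half) measurable_id measurable_neighbourMax fun u i => by
    simp only [neighbourMax, id]
    cases u i <;> simp
  rwa [Measure.map_id] at this

lemma neighbourMaxLaw_not_uniformlyInsertionTolerant :
    ¬ UniformlyInsertionTolerant neighbourMaxLaw := by
  rintro ⟨ε, h0, h⟩
  set A : Set (ℤ → Bool) := {σ | σ (-1) = false} ∩ {σ | σ 1 = false} with hA
  have hAm : MeasurableSet[cylinderEvents ({0}ᶜ : Set ℤ)] A :=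
    (measurable_cylinderEvent_apply (X := fun _ : ℤ => Bool) (Δ := ({0}ᶜ : Set ℤ)) (i := -1)
      (by simp) (MeasurableSet.of_discrete (s := {false}))).inter
    (measurable_cylinderEvent_apply (X := fun _ : ℤ => Bool) (Δ := ({0}ᶜ : Set ℤ)) (i := 1)
      (by simp) (MeasurableSet.of_discrete (s := {false})))
  have hAm' : MeasurableSet A := cylinderEvents_le_pi _ hAm
  have h1 := h.measure_le 0 hAm
  have h2 : neighbourMaxLaw.real (A ∩ {τ | τ 0 = true}) = 0 := by
    rw [neighbourMaxLaw, map_measureReal_apply measurable_neighbourMax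
      (hAm'.inter (measurableSet_site 0))]
    convert measureReal_empty
    ext u
    simp only [hA, neighbourMax, Set.mem_preimage, Set.mem_inter_iff, Set.mem_ofPred_eq,
      Set.mem_empty_iff_false, iff_false, Bool.or_eq_false_iff, Bool.or_eq_true]
    norm_num
    intros
    simp_all
  -- The event contains the vacancy of the four underlying bits at `-1, 0, 1, 2`; these bits also
  -- make site `0` vacant, whence `h2`.
  have h3 : (1 / 2 : ℝ) ^ 4 ≤ neighbourMaxLaw.real A := by
    rw [neighbourMaxLaw, map_measureReal_apply measurable_neighbourMax hAm']
    have := prodBer_real_false half ({-1, 0, 1, 2} : Finset ℤ)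
    have hcard : ({-1, 0, 1, 2} : Finset ℤ).card = 4 := by decide
    rw [hcard, coe_half] at this
    norm_num at this ⊢
    rw [← this]
    refine measureReal_mono fun u hu => ?_
    obtain ⟨a, b, c, d⟩ := hu
    simp [hA, neighbourMax, a, b, c, d]
  rw [h2] at h1
  have := mul_pos h0 (lt_of_lt_of_le (by norm_num) h3)
  linarith

/-- Each occupied underlying bit creates at most two occupied sites, and deleting both costs `ε^2`.
So the vacancy probability is at least that of `π_{1/2}` thinned with probability `ε^2`, on an
interval one site longer to cover the right neighbours. -/
lemma pow_mul_le_minusNoise_neighbourMaxLaw_vacant (ε : unitInterval) (L : ℕ) :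
    (1 - 1 / 2 * (1 - (ε : ℝ) ^ 2)) ^ (L + 1) ≤ (minusNoise neighbourMaxLaw ε).real
      {x | ∀ s ∈ Finset.Ico (0 : ℤ) L, x s = false} := by
  have hε2 : (ε : ℝ) ^ 2 ≤ 1 := pow_le_one₀ ε.2.1 ε.2.2
  have hε0 : 0 ≤ (ε : ℝ) ^ 2 := sq_nonneg _
  set ε' : unitInterval := ⟨(ε : ℝ) ^ 2, hε0, hε2⟩
  set F := Finset.Ico (0 : ℤ) L
  set F' := Finset.Ico (0 : ℤ) (L + 1 : ℕ)
  have h1 : (minusNoise (prodBer ℤ half) ε').real {x | ∀ s ∈ F', x s = false} =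
      (1 - 1 / 2 * (1 - (ε : ℝ) ^ 2)) ^ (L + 1) := by
    rw [minusNoise_prodBer half ε' ⟨1 / 2 * (1 - (ε : ℝ) ^ 2), by nlinarith, by nlinarith⟩ rfl,
      prodBer_real_false]
    simp [F']
  rw [← h1, neighbourMaxLaw, minusNoise_map _ measurable_neighbourMax, minusNoise]
  have hm : Measurable fun (z : (ℤ → Bool) × (ℤ → Bool)) s => neighbourMax z.1 s && !z.2 s :=
    measurable_minus.comp (measurable_neighbourMax.prodMap measurable_id)
  rw [map_measureReal_apply hm (measurableSet_vacant F),
    map_measureReal_apply measurable_minus (measurableSet_vacant F'), measureReal_def,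
    measureReal_def]
  refine ENNReal.toReal_mono (measure_ne_top _ _) ?_
  rw [Measure.prod_apply (measurable_minus (measurableSet_vacant F')),
    Measure.prod_apply (hm (measurableSet_vacant F))]
  refine lintegral_mono fun u => ?_
  have e (G : Finset ℤ) (v : ℤ → Bool) : {y : ℤ → Bool | ∀ s ∈ G, (v s && !y s) = false} =
      {y | ∀ s ∈ G.filter (v · = true), y s = true} := by
    ext y
    simp
  have hcard : (F.filter (neighbourMax u · = true)).card ≤ 2 * (F'.filter (u · = true)).card := by
    have hsub : F.filter (neighbourMax u · = true) ⊆
        F'.filter (u · = true) ∪ (F'.filter (u · = true)).image (· - 1) := by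
      intro i hi
      simp only [F, F', neighbourMax, Finset.mem_filter, Finset.mem_Ico, Finset.mem_union,
        Finset.mem_image, Bool.or_eq_true] at hi ⊢
      push_cast
      rcases hi with ⟨hi, h | h⟩
      · exact .inl ⟨⟨hi.1, by omega⟩, h⟩
      · exact .inr ⟨i + 1, ⟨⟨by omega, by omega⟩, h⟩, by ring⟩
    refine (Finset.card_le_card hsub).trans ((Finset.card_union_le _ _).trans ?_)
    have := Finset.card_image_le (s := F'.filter (u · = true)) (f := (· - 1))
    omega
  have key : (prodBer ℤ ε').real {y | ∀ s ∈ F', (u s && !y s) = false} ≤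
      (prodBer ℤ ε).real {y | ∀ s ∈ F, (neighbourMax u s && !y s) = false} := by
    rw [e, e, prodBer_real_true, prodBer_real_true]
    simp only [ε', ← pow_mul]
    exact pow_le_pow_of_le_one ε.2.1 ε.2.2 hcard
  exact (ENNReal.toReal_le_toReal (measure_ne_top _ _) (measure_ne_top _ _)).1 key

lemma neighbourMaxLaw_rigid : Rigid neighbourMaxLaw := by
  rintro ⟨-, ε, h0, h1, hd⟩
  have hp : half ≤ pMax neighbourMaxLaw := le_sSup neighbourMaxLaw_stochDom
  have hp' : (1 / 2 : ℝ) ≤ pMax neighbourMaxLaw := hp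
  have h0' : (0 : ℝ) < ε := h0
  have hε : 0 < (ε : ℝ) ^ 2 := by positivity
  -- Domination would force the noisy vacancy rate to be at most `1 - p_max ≤ 1/2`, but it exceeds
  -- `1/2` by `ε^2 / 2`.
  have h2 : (1 - 1 / 2 * (1 - (ε : ℝ) ^ 2)) ≤ 1 / 2 := by
    refine le_of_frequently_mul_pow_le (c := 1 - 1 / 2 * (1 - (ε : ℝ) ^ 2)) (by nlinarith)
      (by norm_num) fun N => ⟨N, le_rfl, ?_⟩
    rw [← pow_succ']
    refine (pow_mul_le_minusNoise_neighbourMaxLaw_vacant ε N).trans ((hd.vacant_le _).trans ?_)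
    rw [prodBer_real_false]
    simp only [Int.card_Ico, sub_zero, Int.toNat_natCast]
    exact pow_le_pow_left₀ (sub_nonneg.2 (pMax neighbourMaxLaw).2.2) (by linarith) _
  linarith

end NeighbourMaximum

/-! ### Countable mixtures of measures. -/

section Mixtures

variable {κ : Type*} [Countable κ] {Ω Ω' : Type*} [MeasurableSpace Ω] [MeasurableSpace Ω']

/-- The mixture of the measures `m k` with weights `c k`. -/
noncomputable def mixture (c : κ → ℝ≥0∞) (m : κ → Measure Ω) : Measure Ω :=
  Measure.sum fun k => c k • m k

variable {c : κ → ℝ≥0∞} {m : κ → Measure Ω}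

lemma mixture_isProbabilityMeasure (hc : ∑' k, c k = 1) (hm : ∀ k, IsProbabilityMeasure (m k)) :
    IsProbabilityMeasure (mixture c m) :=
  ⟨by simp [mixture, Measure.sum_apply _ MeasurableSet.univ, hc]⟩

lemma map_mixture {g : Ω → Ω'} (hg : Measurable g) :
    (mixture c m).map g = mixture c fun k => (m k).map g := by
  rw [mixture, Measure.map_sum hg.aemeasurable]
  simp only [Measure.map_smul, mixture]

lemma mixture_apply {A : Set Ω} (hA : MeasurableSet A) :
    mixture c m A = ∑' k, c k * m k A := by
  rw [mixture, Measure.sum_apply _ hA]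
  simp

lemma mul_le_mixture_real (hc : ∑' k, c k = 1) (hm : ∀ k, IsProbabilityMeasure (m k)) (k : κ)
    (A : Set Ω) : (c k).toReal * (m k).real A ≤ (mixture c m).real A := by
  have := mixture_isProbabilityMeasure hc hm
  rw [measureReal_def, ← ENNReal.toReal_mul]
  exact ENNReal.toReal_mono (measure_ne_top _ _) (Measure.le_sum (fun k => c k • m k) k A)

lemma hasSum_integral_mixture (hc : ∑' k, c k = 1) (hm : ∀ k, IsProbabilityMeasure (m k))
    {f : Ω → ℝ} (hf : Measurable f) {C : ℝ} (hC : ∀ ω, ‖f ω‖ ≤ C) :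
    HasSum (fun k => (c k).toReal * ∫ ω, f ω ∂m k) (∫ ω, f ω ∂mixture c m) := by
  have := mixture_isProbabilityMeasure hc hm
  have h := hasSum_integral_measure (μ := fun k => c k • m k) (f := f)
    (.of_bound hf.aestronglyMeasurable C (.of_forall hC) : Integrable f (mixture c m))
  simp only [integral_smul_measure, smul_eq_mul] at h
  exact h

lemma hasSum_weights (hc : ∑' k, c k = 1) : HasSum (fun k => (c k).toReal) 1 := by
  have h : ∑' k, c k ≠ ∞ := by simp [hc]
  have := (ENNReal.summable_toReal h).hasSum
  rwa [← ENNReal.tsum_toReal_eq (fun k => ENNReal.ne_top_of_tsum_ne_top h k), hc,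
    ENNReal.toReal_one] at this

lemma mixture_le_mul (K : ℝ≥0∞) {A B : Set Ω} (hA : MeasurableSet A) (hB : MeasurableSet B)
    (h : ∀ k, m k A ≤ K * m k B) : mixture c m A ≤ K * mixture c m B := by
  rw [mixture_apply hA, mixture_apply hB, ← ENNReal.tsum_mul_left]
  refine ENNReal.tsum_le_tsum fun k => ?_
  rw [mul_left_comm]
  exact mul_le_mul_right (h k) _

lemma StochDom.mixture [Countable S] {μ : Measure (S → Bool)} {c : κ → ℝ≥0∞}
    {m : κ → Measure (S → Bool)} (hc : ∑' k, c k = 1) (hm : ∀ k, IsProbabilityMeasure (m k))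
    (h : ∀ k, StochDom μ (m k)) : StochDom μ (mixture c m) := by
  intro f hf hfm
  obtain ⟨C, hC⟩ := exists_bound hf
  have h1 := (hasSum_weights hc).mul_right (∫ σ, f σ ∂μ)
  rw [one_mul] at h1
  refine hasSum_le (fun k => ?_) h1 (hasSum_integral_mixture hc hm hf.measurable hC)
  exact mul_le_mul_of_nonneg_left (h k f hf hfm) ENNReal.toReal_nonneg

lemma minusNoise_mixture [Countable S] {c : κ → ℝ≥0∞} {m : κ → Measure (S → Bool)} (ε : unitInterval) :
    minusNoise (Domination.mixture c m) ε = Domination.mixture c fun k => minusNoise (m k) ε := by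
  rw [minusNoise, Domination.mixture, Measure.prod_sum_left]
  simp_rw [Measure.prod_smul_left]
  exact map_mixture measurable_minus

end Mixtures

/-! ### Averages over phases and dyadic scales. -/

section DyadicMixture

/-- The average of a family of measures over `k < n`. -/
noncomputable def cyclicAverage {Ω : Type*} [MeasurableSpace Ω] (n : ℕ) (m : ℕ → Measure Ω) :
    Measure Ω :=
  mixture (fun _ : Fin n => (n : ℝ≥0∞)⁻¹) fun k => m k

lemma tsum_cyclicAverage {n : ℕ} (hn : n ≠ 0) : ∑' _ : Fin n, (n : ℝ≥0∞)⁻¹ = 1 := by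
  rw [tsum_fintype]
  simp [ENNReal.mul_inv_cancel, hn]

/-- The unit shift permutes the `n` phases cyclically. -/
lemma map_shift_cyclicAverage {n : ℕ} {m : ℕ → Measure (ℤ → Bool)}
    (hm : ∀ k, (m k).map (fun (σ : ℤ → Bool) (i : ℤ) => σ (i + 1)) = m (k + 1)) (h0 : m n = m 0) :
    (cyclicAverage n m).map (fun (σ : ℤ → Bool) (i : ℤ) => σ (i + 1)) = cyclicAverage n m := by
  rw [cyclicAverage, map_mixture (measurable_shift 1)]
  simp only [mixture, Measure.sum_fintype, hm]
  rw [Fin.sum_univ_eq_sum_range (fun k => (n : ℝ≥0∞)⁻¹ • m (k + 1)),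
    Fin.sum_univ_eq_sum_range (fun k => (n : ℝ≥0∞)⁻¹ • m k)]
  obtain _ | n := n
  · simp
  · rw [Finset.sum_range_succ, h0,
      ← Finset.sum_range_succ' (fun k => ((n + 1 : ℕ) : ℝ≥0∞)⁻¹ • m k) n]

/-- The mixture, over all scales `n = 2 ^ j`, of the averages over a period `n` of a family of
measures. -/
noncomputable def dyadicMixture {Ω : Type*} [MeasurableSpace Ω] (m : ℕ → ℕ → Measure Ω) :
    Measure Ω :=
  mixture (fun j : ℕ => (2 : ℝ≥0∞)⁻¹ ^ (j + 1)) fun j => cyclicAverage (2 ^ j) (m (2 ^ j))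

lemma tsum_dyadicMixture : ∑' j : ℕ, (2 : ℝ≥0∞)⁻¹ ^ (j + 1) = 1 := by
  rw [ENNReal.tsum_geometric_add_one, ENNReal.one_sub_inv_two, inv_inv,
    ENNReal.inv_mul_cancel (by norm_num) (by norm_num)]

/-- The weight in `dyadicMixture m` of each of the measures at scale `2 ^ j`. -/
noncomputable def dyadicWeight (j : ℕ) : ℝ := 2⁻¹ ^ (j + 1) * (2 ^ j)⁻¹

lemma dyadicWeight_pos (j : ℕ) : 0 < dyadicWeight j := by unfold dyadicWeight; positivity

variable {Ω : Type*} [MeasurableSpace Ω] {m : ℕ → ℕ → Measure Ω}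

lemma cyclicAverage_isProbabilityMeasure (hm : ∀ n k, IsProbabilityMeasure (m n k)) (j : ℕ) :
    IsProbabilityMeasure (cyclicAverage (2 ^ j) (m (2 ^ j))) :=
  mixture_isProbabilityMeasure (tsum_cyclicAverage (by positivity)) fun k => hm _ k

lemma dyadicMixture_isProbabilityMeasure (hm : ∀ n k, IsProbabilityMeasure (m n k)) :
    IsProbabilityMeasure (dyadicMixture m) :=
  mixture_isProbabilityMeasure tsum_dyadicMixture (cyclicAverage_isProbabilityMeasure hm)

lemma dyadicMixture_translationInvariant {m : ℕ → ℕ → Measure (ℤ → Bool)}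
    (hm : ∀ n k, (m n k).map (fun (σ : ℤ → Bool) (i : ℤ) => σ (i + 1)) = m n (k + 1))
    (h0 : ∀ n, n ≠ 0 → m n n = m n 0) : TranslationInvariant (dyadicMixture m) := by
  refine translationInvariant_of_shift_one ?_
  rw [dyadicMixture, map_mixture (measurable_shift 1)]
  congr 1
  funext j
  exact map_shift_cyclicAverage (hm _) (h0 _ (by positivity))

lemma StochDom.dyadicMixture [Countable S] {μ : Measure (S → Bool)}
    {m : ℕ → ℕ → Measure (S → Bool)} (hm : ∀ n k, IsProbabilityMeasure (m n k))
    (h : ∀ n k, n ≠ 0 → StochDom μ (m n k)) : StochDom μ (dyadicMixture m) :=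
  StochDom.mixture tsum_dyadicMixture (cyclicAverage_isProbabilityMeasure hm) fun j =>
    StochDom.mixture (tsum_cyclicAverage (by positivity)) (fun k => hm _ k)
      fun k => h _ k (by positivity)

lemma minusNoise_dyadicMixture [Countable S] {m : ℕ → ℕ → Measure (S → Bool)} (ε : unitInterval) :
    minusNoise (Domination.dyadicMixture m) ε =
      Domination.dyadicMixture fun n k => minusNoise (m n k) ε := by
  rw [Domination.dyadicMixture, minusNoise_mixture]
  simp_rw [cyclicAverage, minusNoise_mixture]
  rfl

lemma toReal_weights (j : ℕ) : ((2 : ℝ≥0∞)⁻¹ ^ (j + 1)).toReal *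
    (((2 ^ j : ℕ) : ℝ≥0∞)⁻¹).toReal = dyadicWeight j := by
  simp [dyadicWeight]

lemma mul_le_dyadicMixture_real (hm : ∀ n k, IsProbabilityMeasure (m n k)) (j : ℕ) (A : Set Ω) :
    dyadicWeight j * (m (2 ^ j) 0).real A ≤ (dyadicMixture m).real A := by
  have hpos : 0 < 2 ^ j := by positivity
  rw [← toReal_weights, mul_assoc]
  refine le_trans (mul_le_mul_of_nonneg_left ?_ ENNReal.toReal_nonneg)
    (mul_le_mixture_real tsum_dyadicMixture (cyclicAverage_isProbabilityMeasure hm) j A)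
  exact mul_le_mixture_real (m := fun k : Fin (2 ^ j) => m (2 ^ j) k)
    (tsum_cyclicAverage hpos.ne') (fun k => hm _ k) ⟨0, hpos⟩ A

lemma dyadicMixture_le_mul (K : ℝ≥0∞) {A B : Set Ω} (hA : MeasurableSet A)
    (hB : MeasurableSet B) (h : ∀ n k, n ≠ 0 → m n k A ≤ K * m n k B) :
    dyadicMixture m A ≤ K * dyadicMixture m B :=
  mixture_le_mul K hA hB fun _ => mixture_le_mul K hA hB fun k => h _ k (by positivity)

lemma integral_mixture_nonneg {κ : Type*} [Countable κ] {c : κ → ℝ≥0∞} {m : κ → Measure Ω}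
    (hc : ∑' k, c k = 1) (hm : ∀ k, IsProbabilityMeasure (m k)) {f : Ω → ℝ} (hf : Measurable f)
    {C : ℝ} (hC : ∀ ω, ‖f ω‖ ≤ C) (h : ∀ k, 0 ≤ ∫ ω, f ω ∂m k) : 0 ≤ ∫ ω, f ω ∂mixture c m :=
  (hasSum_integral_mixture hc hm hf hC).nonneg fun k => mul_nonneg ENNReal.toReal_nonneg (h k)

lemma mul_le_integral_mixture {κ : Type*} [Countable κ] {c : κ → ℝ≥0∞} {m : κ → Measure Ω}
    (hc : ∑' k, c k = 1) (hm : ∀ k, IsProbabilityMeasure (m k)) {f : Ω → ℝ} (hf : Measurable f)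
    {C : ℝ} (hC : ∀ ω, ‖f ω‖ ≤ C) (h : ∀ k, 0 ≤ ∫ ω, f ω ∂m k) (k : κ) :
    (c k).toReal * ∫ ω, f ω ∂m k ≤ ∫ ω, f ω ∂mixture c m :=
  le_hasSum (hasSum_integral_mixture hc hm hf hC) k fun l _ =>
    mul_nonneg ENNReal.toReal_nonneg (h l)

lemma integral_dyadicMixture_nonneg (hm : ∀ n k, IsProbabilityMeasure (m n k)) {f : Ω → ℝ}
    (hf : Measurable f) {C : ℝ} (hC : ∀ ω, ‖f ω‖ ≤ C) (h : ∀ n k, 0 ≤ ∫ ω, f ω ∂m n k) :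
    0 ≤ ∫ ω, f ω ∂dyadicMixture m :=
  integral_mixture_nonneg tsum_dyadicMixture (cyclicAverage_isProbabilityMeasure hm) hf hC
    fun _ => integral_mixture_nonneg (tsum_cyclicAverage (by positivity)) (fun k => hm _ k) hf hC
      fun k => h _ k

lemma mul_le_integral_dyadicMixture (hm : ∀ n k, IsProbabilityMeasure (m n k)) {f : Ω → ℝ}
    (hf : Measurable f) {C : ℝ} (hC : ∀ ω, ‖f ω‖ ≤ C) (h : ∀ n k, 0 ≤ ∫ ω, f ω ∂m n k) (j : ℕ) :
    dyadicWeight j * ∫ ω, f ω ∂m (2 ^ j) 0 ≤ ∫ ω, f ω ∂dyadicMixture m := by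
  have hpos : 0 < 2 ^ j := by positivity
  rw [← toReal_weights, mul_assoc]
  refine le_trans (mul_le_mul_of_nonneg_left ?_ ENNReal.toReal_nonneg)
    (mul_le_integral_mixture tsum_dyadicMixture (cyclicAverage_isProbabilityMeasure hm) hf hC
      (fun _ => integral_mixture_nonneg (tsum_cyclicAverage (by positivity))
        (fun k => hm _ k) hf hC fun k => h _ k) j)
  exact mul_le_integral_mixture (m := fun k : Fin (2 ^ j) => m (2 ^ j) k)
    (tsum_cyclicAverage hpos.ne') (fun k => hm _ k) hf hC (fun k => h _ k) ⟨0, hpos⟩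

end DyadicMixture

/-! ### Block configurations that survive deletion. -/

section Vacancies

variable [Countable S]

/-- The parameter `1/4`. -/
noncomputable def quarter : unitInterval := ⟨1 / 4, by norm_num, by norm_num⟩

lemma coe_quarter : (quarter : ℝ) = 1 / 4 := rfl

/-- Up to an exponentially small factor with the optimal rate, increasing events that require an
occupied site gain from passing from `π_{1/4}` to `π_{1/2}`. -/
lemma quarter_real_le {F : Finset S} {A : Set (S → Bool)} (hA : MeasurableSet A)
    (hup : IsUpperSet A) (hF : ∀ x ∈ A, ∃ s ∈ F, x s = true) :
    (prodBer S quarter).real A ≤ (1 - (3 / 4) ^ F.card / 2) * (prodBer S half).real A := by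
  -- `π_{1/4}` is the law of the minimum of two independent `π_{1/2}` fields, and both lie in the
  -- increasing event if their minimum does.
  have h1 : (prodBer S quarter).real A ≤ (prodBer S half).real A ^ 2 := by
    have hm : Measurable fun (x : (S → Bool) × (S → Bool)) s => x.1 s && x.2 s :=
      measurable_pi_lambda _ fun s =>
        (measurable_of_countable fun y : Bool × Bool => y.1 && y.2).comp
          (f := fun x : (S → Bool) × (S → Bool) => (x.1 s, x.2 s)) (by fun_prop)
    rw [← map_and_prodBer half half quarter (by rw [coe_half, coe_quarter]; norm_num),
      map_measureReal_apply hm hA, sq, ← measureReal_prod_prod]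
    refine measureReal_mono fun z hz => ⟨hup ?_ hz, hup ?_ hz⟩ <;> intro s
    · simp only; cases z.1 s <;> simp
    · simp only; cases z.1 s <;> simp
  have h2 : (prodBer S quarter).real A ≤ 1 - (3 / 4) ^ F.card := by
    have := prodBer_real_false quarter F
    rw [coe_quarter] at this
    norm_num at this
    rw [← this, ← probReal_compl_eq_one_sub (measurableSet_vacant F)]
    refine measureReal_mono fun x hx hx' => ?_
    obtain ⟨s, hs, h⟩ := hF x hx
    have := hx' s hs
    simp [h] at this
  have h3 : (prodBer S half).real A ≤ 1 := measureReal_le_one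
  have h4 : 0 ≤ (prodBer S half).real A := measureReal_nonneg
  have h5 : (3 / 4 : ℝ) ^ F.card ≤ 1 := pow_le_one₀ (by norm_num) (by norm_num)
  set a := (prodBer S half).real A
  set d := (3 / 4 : ℝ) ^ F.card
  -- If `a ≤ 1 - d/2`, use the bound `a^2`; otherwise use `1 - d ≤ (1 - d/2)^2`.
  rcases le_total a (1 - d / 2) with h | h
  · nlinarith
  · nlinarith [sq_nonneg d]

/-- Comparison of `π_{1/4}` with the mixture of `π_{1/2}` and the vacant configuration. -/
lemma quarter_integral_le (F : Finset S) {g : (S → Bool) → ℝ} (hg : Continuous g)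
    (hm : Monotone g) (hF : ∀ x, (∀ s ∈ F, x s = false) → g x = g fun _ => false) :
    ∫ x, g x ∂prodBer S quarter ≤ (3 / 4) ^ F.card / 2 * g (fun _ => false) +
      (1 - (3 / 4) ^ F.card / 2) * ∫ x, g x ∂prodBer S half := by
  set d := (3 / 4 : ℝ) ^ F.card / 2 with hd
  have hd1 : (3 / 4 : ℝ) ^ F.card ≤ 1 := pow_le_one₀ (by norm_num) (by norm_num)
  set g₀ := g fun _ => false
  have hG0 : ∀ x, 0 ≤ g x - g₀ := fun x => sub_nonneg.2 (hm fun s => Bool.false_le _)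
  have hGc : Continuous fun x => g x - g₀ := hg.sub continuous_const
  have hGi (p : unitInterval) : Integrable (fun x => g x - g₀) (prodBer S p) :=
    integrable_comp _ hGc measurable_id
  -- Layer-cake integration: each level set `{t < g - g₀}` with `t > 0` is increasing and needs an
  -- occupied site of `F`.
  have key : ∫ x, (g x - g₀) ∂prodBer S quarter ≤
      (1 - d) * ∫ x, (g x - g₀) ∂prodBer S half := by
    have h1 : 0 ≤ (1 - d) * ∫ x, (g x - g₀) ∂prodBer S half :=
      mul_nonneg (by linarith) (integral_nonneg hG0)
    rw [← ENNReal.ofReal_le_ofReal_iff h1, ENNReal.ofReal_mul (by linarith),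
      ofReal_integral_eq_lintegral_ofReal (hGi _) (.of_forall hG0),
      ofReal_integral_eq_lintegral_ofReal (hGi _) (.of_forall hG0),
      lintegral_eq_lintegral_meas_lt _ (.of_forall hG0) hGc.measurable.aemeasurable,
      lintegral_eq_lintegral_meas_lt _ (.of_forall hG0) hGc.measurable.aemeasurable,
      ← lintegral_const_mul' _ _ ENNReal.ofReal_ne_top]
    refine setLIntegral_mono' measurableSet_Ioi fun t ht => ?_
    have := quarter_real_le (F := F) (A := {x | t < g x - g₀})
      (measurableSet_lt measurable_const hGc.measurable)
      (fun x y hxy hx => lt_of_lt_of_le hx (sub_le_sub_right (hm hxy) _)) (fun x hx => by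
        by_contra! h
        have h' := hF x fun s hs => by simpa using h s hs
        have hx' : t < g x - g₀ := hx
        rw [h', sub_self] at hx'
        exact absurd ht (not_lt.2 hx'.le))
    rw [← ofReal_measureReal, ← ofReal_measureReal, ← ENNReal.ofReal_mul (by linarith)]
    exact ENNReal.ofReal_le_ofReal this
  have e (p : unitInterval) : ∫ x, (g x - g₀) ∂prodBer S p = ∫ x, g x ∂prodBer S p - g₀ := by
    have hgi : Integrable g (prodBer S p) := integrable_comp _ hg measurable_id
    rw [integral_sub hgi (integrable_const _)]
    simp
  rw [e, e] at key
  linarith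

lemma continuous_integral_piecewise {Ω : Type*} [MeasurableSpace Ω] (P : Measure Ω)
    [IsFiniteMeasure P] {f : (S → Bool) → ℝ} (hf : Continuous f) (B : Set S)
    [DecidablePred (· ∈ B)] {u : Ω → S → Bool} (hu : Measurable u) :
    Continuous fun σ : S → Bool => ∫ ω, f (B.piecewise (u ω) σ) ∂P := by
  obtain ⟨C, hC⟩ := exists_bound hf
  refine continuous_of_dominated (bound := fun _ => C) (fun σ => ?_)
    (fun σ => .of_forall fun ω => hC _) (integrable_const C) (.of_forall fun ω => ?_)
  · exact (integrable_comp _ hf ((measurable_piecewise B).comp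
      (hu.prodMk measurable_const))).aestronglyMeasurable
  · exact hf.comp (continuous_piecewise_right B (u ω))

lemma integral_resample {T : Type*} [Countable T] (p : unitInterval) (B : Set T) [DecidablePred (· ∈ B)]
    {φ : (T → Bool) → ℝ} (hφ : Integrable φ (prodBer T p)) :
    Integrable (fun x : (T → Bool) × (T → Bool) => φ (B.piecewise x.2 x.1))
      ((prodBer T p).prod (prodBer T p)) ∧
    ∫ x, φ x ∂prodBer T p = ∫ x, ∫ y, φ (B.piecewise y x) ∂prodBer T p ∂prodBer T p := by
  have hm : Measurable fun x : (T → Bool) × (T → Bool) => B.piecewise x.2 x.1 :=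
    (measurable_piecewise B).comp measurable_swap
  have h := map_piecewise_prodBer p B
  have h1 : Integrable (fun x : (T → Bool) × (T → Bool) => φ (B.piecewise x.2 x.1))
      ((prodBer T p).prod (prodBer T p)) := by
    rw [← h] at hφ
    exact hφ.comp_measurable hm
  refine ⟨h1, ?_⟩
  have h2 := integral_map hm.aemeasurable (by rw [h]; exact hφ.aestronglyMeasurable)
  rw [h] at h2
  rw [h2, integral_prod _ h1]

/-- Configurations constant on blocks of size `n`, vacant blocks having probability
`(3/4)^n / 2`, still dominate `π_{1/4}` after occupied sites are deleted with probability `1/2`. -/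
theorem stochDom_minusNoise_blocks {J : Type*} [Countable J] (b : S → J) (F : J → Finset S)
    (hF : ∀ j s, s ∈ F j ↔ b s = j) {n : ℕ} (hn : ∀ j, (F j).card = n) (q : unitInterval)
    (hq : (q : ℝ) = 1 - (3 / 4) ^ n / 2) :
    StochDom (prodBer S quarter)
      (minusNoise ((prodBer J q).map fun W s => W (b s)) half) := by
  classical
  have hb : Measurable fun (W : J → Bool) s => W (b s) :=
    measurable_pi_lambda _ fun s => measurable_pi_apply (b s)
  have := Measure.isProbabilityMeasure_map (μ := prodBer J q) hb.aemeasurable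
  refine stochDom_of_resample_block b quarter _ fun j f hf hm => ?_
  rw [minusNoise_map _ hb]
  set Ψ : (J → Bool) × (S → Bool) → S → Bool := fun z s => z.1 (b s) && !z.2 s with hΨ
  have hΨm : Measurable Ψ := measurable_minus.comp (hb.prodMap measurable_id)
  set B : Set S := b ⁻¹' {j}
  set R : (S → Bool) → ℝ := fun σ => ∫ η, f (B.piecewise η σ) ∂prodBer S quarter with hR
  have hRc : Continuous R := continuous_integral_piecewise _ hf B measurable_id
  have hcm (c : Bool) : Measurable fun (ξ : S → Bool) s => c && !ξ s :=
    measurable_minus.comp (measurable_prodMk_left (x := fun _ => c))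
  set H : Bool → (S → Bool) → ℝ := fun c σ =>
    ∫ ξ, f (B.piecewise (fun s => c && !ξ s) σ) ∂prodBer S half with hH
  have hHc (c : Bool) : Continuous (H c) := continuous_integral_piecewise _ hf B (hcm c)
  -- After deletion with probability `1/2`, an occupied block looks like `π_{1/2}` and a vacant one
  -- stays vacant. Together they form the mixture that dominates `π_{1/4}` in `quarter_integral_le`.
  have hRH (σ : S → Bool) : R σ ≤ q * H true σ + (1 - q) * H false σ := by
    have h := quarter_integral_le (F j) (hf.comp (continuous_piecewise_left B σ))
      (hm.comp (monotone_piecewise_left B σ)) (fun x hx => by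
        simp only [Function.comp_apply]
        congr 1
        funext s
        by_cases hs : s ∈ B
        · simp [Set.piecewise, hs, hx s ((hF j s).2 hs)]
        · simp [Set.piecewise, hs])
    have e1 : H true σ = ∫ x, (f ∘ fun η => B.piecewise η σ) x ∂prodBer S half := by
      conv_rhs => rw [← map_not_prodBer half half (by rw [coe_half]; norm_num)]
      have hnot : Measurable fun (x : S → Bool) s => !x s := by simpa using hcm true
      rw [integral_map hnot.aemeasurable
        (hf.comp (continuous_piecewise_left B σ)).measurable.aestronglyMeasurable]
      simp [hH]
    have e2 : H false σ = (f ∘ fun η => B.piecewise η σ) fun _ => false := by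
      simp [hH]
    rw [e1, e2, hq, ← hn j]
    refine h.trans (le_of_eq ?_)
    ring
  -- The deletion marks in block `j` may be refreshed, which makes the contents of that block, given
  -- its state `c`, independent of the other sites.
  have hφ (W : J → Bool) (c : Bool) :
      ∫ ξ, f (Ψ (Function.update W j c, ξ)) ∂prodBer S half =
        ∫ ξ, H c (Ψ (W, ξ)) ∂prodBer S half := by
    have hΨW (W : J → Bool) : Measurable fun ξ => Ψ (W, ξ) := hΨm.comp measurable_prodMk_left
    rw [(integral_resample half B (integrable_comp _ hf (hΨW _))).2]
    refine integral_congr_ae (.of_forall fun ξ => integral_congr_ae (.of_forall fun ξ' => ?_))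
    simp only
    congr 1
    funext s
    by_cases hs : s ∈ B
    · have : b s = j := hs
      simp [hΨ, Set.piecewise, hs, this]
    · have : b s ≠ j := hs
      simp [hΨ, Set.piecewise, hs, this]
  rw [integral_map hΨm.aemeasurable hRc.measurable.aestronglyMeasurable,
    integral_map hΨm.aemeasurable hf.measurable.aestronglyMeasurable,
    integral_prod _ (integrable_comp _ hRc hΨm), integral_prod _ (integrable_comp _ hf hΨm)]
  have hΦi := (integrable_comp ((prodBer J q).prod (prodBer S half)) hf hΨm).integral_prod_left
  obtain ⟨hΦi', hΦ⟩ := integral_resample q {j} hΦi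
  rw [hΦ]
  refine integral_mono (integrable_comp _ hRc hΨm).integral_prod_left
    hΦi'.integral_prod_left fun W => ?_
  have hW (W' : J → Bool) : ({j} : Set J).piecewise W' W = Function.update W j (W' j) := by
    funext l
    by_cases hl : l = j
    · subst hl; simp [Set.piecewise]
    · simp [Set.piecewise, hl]
  simp only [hW, hφ]
  rw [integral_eval_prodBer q j fun c => ∫ ξ, H c (Ψ (W, ξ)) ∂prodBer S half,
    ← integral_const_mul, ← integral_const_mul, ← integral_add]
  · refine integral_mono (integrable_comp _ hRc (hΨm.comp measurable_prodMk_left)) ?_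
      fun ξ => hRH _
    exact ((integrable_comp _ (hHc _) (hΨm.comp measurable_prodMk_left)).const_mul _).add
      ((integrable_comp _ (hHc _) (hΨm.comp measurable_prodMk_left)).const_mul _)
  · exact (integrable_comp _ (hHc _) (hΨm.comp measurable_prodMk_left)).const_mul _
  · exact (integrable_comp _ (hHc _) (hΨm.comp measurable_prodMk_left)).const_mul _

end Vacancies

/-! ### A measure dominating `π_{1/4}` that is not rigid. -/

section Blocks

/-- The probability with which a block of size `n` is occupied. -/
noncomputable def blockParam (n : ℕ) : unitInterval :=
  ⟨1 - (3 / 4) ^ n / 2, by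
    have : (3 / 4 : ℝ) ^ n ≤ 1 := pow_le_one₀ (by norm_num) (by norm_num)
    linarith, by
    have : (0 : ℝ) ≤ (3 / 4 : ℝ) ^ n := by positivity
    linarith⟩

lemma coe_blockParam (n : ℕ) : (blockParam n : ℝ) = 1 - (3 / 4) ^ n / 2 := rfl

/-- The index of the block of size `n` containing a site, where blocks start at the sites `i` with
`n ∣ i + k`. -/
def blockIndex (n k : ℕ) (i : ℤ) : ℤ := (i + k) / n

/-- The law of a configuration which is constant on each block, the blocks being independently
occupied with probability `blockParam n`. -/
noncomputable def blockLaw (n k : ℕ) : Measure (ℤ → Bool) :=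
  (prodBer ℤ (blockParam n)).map fun W i => W (blockIndex n k i)

lemma measurable_comp_blockIndex (n k : ℕ) :
    Measurable fun (W : ℤ → Bool) i => W (blockIndex n k i) :=
  measurable_pi_lambda _ fun i => measurable_pi_apply (blockIndex n k i)

lemma blockLaw_isProbabilityMeasure (n k : ℕ) : IsProbabilityMeasure (blockLaw n k) :=
  Measure.isProbabilityMeasure_map (measurable_comp_blockIndex n k).aemeasurable

lemma map_shift_blockLaw (n k : ℕ) :
    (blockLaw n k).map (fun (σ : ℤ → Bool) (i : ℤ) => σ (i + 1)) = blockLaw n (k + 1) := by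
  rw [blockLaw, Measure.map_map (measurable_shift 1) (measurable_comp_blockIndex n k), blockLaw]
  congr 1
  funext W i
  simp only [Function.comp_apply, blockIndex]
  congr 2
  push_cast
  ring

lemma blockLaw_self {n : ℕ} (hn : n ≠ 0) : blockLaw n n = blockLaw n 0 := by
  rw [blockLaw, blockLaw]
  conv_rhs => rw [← map_shift_prodBer (blockParam n) 1,
    Measure.map_map (measurable_comp_blockIndex n 0) (measurable_shift 1)]
  congr 1
  funext W i
  simp only [Function.comp_apply, blockIndex]
  congr 1
  rw [Int.add_ediv_of_dvd_right dvd_rfl, Int.ediv_self (by exact_mod_cast hn)]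
  simp

lemma stochDom_minusNoise_blockLaw {n : ℕ} (hn : n ≠ 0) (k : ℕ) :
    StochDom (prodBer ℤ quarter) (minusNoise (blockLaw n k) half) := by
  refine stochDom_minusNoise_blocks (blockIndex n k)
    (fun j => Finset.Ico (j * n - k) (j * n - k + n)) (fun j i => ?_) (n := n) (fun j => ?_) _
    (coe_blockParam n)
  · have hn' : (0 : ℤ) < n := by omega
    rw [blockIndex, Finset.mem_Ico, Int.ediv_eq_iff_of_pos hn']
    constructor
    · rintro ⟨h1, h2⟩; constructor <;> linarith
    · rintro ⟨h1, h2⟩; constructor <;> linarith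
  · simp

lemma pow_le_blockLaw_vacant {n : ℕ} (hn : n ≠ 0) (M : ℕ) :
    ((3 / 4) ^ n / 2) ^ M ≤
      (blockLaw n 0).real {x | ∀ s ∈ Finset.Ico (0 : ℤ) (n * M : ℕ), x s = false} := by
  have h := prodBer_real_false (blockParam n) (Finset.Ico (0 : ℤ) M)
  rw [coe_blockParam] at h
  simp only [sub_sub_cancel, Int.card_Ico, sub_zero, Int.toNat_natCast] at h
  rw [← h, blockLaw, map_measureReal_apply (measurable_comp_blockIndex n 0)
    (measurableSet_vacant _)]
  refine measureReal_mono fun W hW i hi => hW _ ?_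
  have hn' : (0 : ℤ) < n := by omega
  simp only [Finset.mem_Ico, blockIndex] at hi ⊢
  push_cast at hi ⊢
  rw [add_zero]
  exact ⟨Int.ediv_nonneg hi.1 hn'.le, Int.ediv_lt_of_lt_mul hn' (by linarith)⟩

lemma dyadicBlocks_isProbabilityMeasure : IsProbabilityMeasure (dyadicMixture blockLaw) :=
  dyadicMixture_isProbabilityMeasure blockLaw_isProbabilityMeasure

lemma dyadicBlocks_translationInvariant : TranslationInvariant (dyadicMixture blockLaw) :=
  dyadicMixture_translationInvariant map_shift_blockLaw fun _ => blockLaw_self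

lemma stochDom_minusNoise_dyadicBlocks :
    StochDom (prodBer ℤ quarter) (minusNoise (dyadicMixture blockLaw) half) := by
  rw [minusNoise_dyadicMixture]
  refine StochDom.dyadicMixture (fun n k => ?_) fun n k hn => stochDom_minusNoise_blockLaw hn k
  have := blockLaw_isProbabilityMeasure n k
  infer_instance

lemma stochDom_dyadicBlocks : StochDom (prodBer ℤ quarter) (dyadicMixture blockLaw) :=
  have := dyadicBlocks_isProbabilityMeasure
  stochDom_minusNoise_dyadicBlocks.trans (minusNoise_stochDom _ _)

lemma dyadicBlocks_dominatesProduct : DominatesProduct (dyadicMixture blockLaw) :=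
  ⟨quarter, Subtype.coe_lt_coe.1 (by norm_num [coe_quarter]), stochDom_dyadicBlocks⟩

/-- Vacancy of `N` consecutive blocks at scale `n = 2^j` gives `w_j ((3/4)^n / 2)^N ≤ (1-p)^{nN}`.
Letting `N → ∞` removes the weight `w_j`; letting `n → ∞` afterwards removes the factor `1/2`. -/
lemma pMax_dyadicBlocks_le : pMax (dyadicMixture blockLaw) ≤ quarter := by
  have := dyadicBlocks_isProbabilityMeasure
  refine sSup_le fun p hp => ?_
  have hp0 : (0 : ℝ) ≤ 1 - p := sub_nonneg.2 p.2.2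
  have h1 (j : ℕ) : (3 / 4 : ℝ) ^ 2 ^ j / 2 ≤ (1 - p) ^ 2 ^ j := by
    refine le_of_frequently_mul_pow_le (dyadicWeight_pos j) (by positivity)
      fun N => ⟨N, le_rfl, ?_⟩
    have h2 := StochDom.vacant_le hp (Finset.Ico (0 : ℤ) (2 ^ j * N : ℕ))
    rw [prodBer_real_false] at h2
    simp only [Int.card_Ico, sub_zero, Int.toNat_natCast] at h2
    rw [← pow_mul]
    refine le_trans ?_ h2
    refine le_trans ?_ (mul_le_dyadicMixture_real blockLaw_isProbabilityMeasure j _)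
    exact mul_le_mul_of_nonneg_left (pow_le_blockLaw_vacant (by positivity) N)
      (dyadicWeight_pos j).le
  have h2 : (3 / 4 : ℝ) ≤ 1 - p := by
    refine le_of_frequently_mul_pow_le (c := 1 / 2) (by norm_num) hp0
      fun N => ⟨2 ^ N, Nat.lt_two_pow_self.le, ?_⟩
    linarith [h1 N]
  have h3 : (p : ℝ) ≤ 1 / 4 := by linarith
  exact h3

lemma dyadicBlocks_not_rigid : ¬ Rigid (dyadicMixture blockLaw) := fun h =>
  h ⟨(prodBer_mono pMax_dyadicBlocks_le).trans stochDom_dyadicBlocks, half, half_param_pos,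
    half_param_lt_one, (prodBer_mono pMax_dyadicBlocks_le).trans stochDom_minusNoise_dyadicBlocks⟩

end Blocks

/-! ### Parities of independent bits. -/

section Parity

variable {ι : Type*}

/-- The sign of a bit: `-1` for an occupied site and `1` for a vacant one. -/
def sgn (b : Bool) : ℝ := if b then -1 else 1

@[simp] lemma sgn_true : sgn true = -1 := rfl

@[simp] lemma sgn_false : sgn false = 1 := rfl

lemma sgn_not (b : Bool) : sgn (!b) = -sgn b := by cases b <;> simp

lemma sgn_mul_self (b : Bool) : sgn b * sgn b = 1 := by cases b <;> simp

lemma sgn_injective : Function.Injective sgn := by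
  intro a b h
  cases a <;> cases b <;> simp at h ⊢ <;> norm_num at h

lemma prod_sgn_eq_or (F : Finset ι) (u : ι → Bool) :
    ∏ j ∈ F, sgn (u j) = 1 ∨ ∏ j ∈ F, sgn (u j) = -1 := by
  refine Finset.prod_induction (fun j => sgn (u j)) (fun a => a = 1 ∨ a = -1) ?_ (.inl rfl)
    fun j _ => by cases u j <;> simp
  rintro a b (rfl | rfl) (rfl | rfl) <;> norm_num

open Classical in
/-- The configuration whose value at `i` is the parity of `u` on `B i`. -/
noncomputable def parityField (B : ι → Finset ι) (u : ι → Bool) (i : ι) : Bool :=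
  decide (∏ j ∈ B i, sgn (u j) = -1)

lemma sgn_parityField (B : ι → Finset ι) (u : ι → Bool) (i : ι) :
    sgn (parityField B u i) = ∏ j ∈ B i, sgn (u j) := by
  unfold parityField
  rcases prod_sgn_eq_or (B i) u with h | h <;> rw [h]
  · have : ¬ ((1 : ℝ) = -1) := by norm_num
    simp [this]
  · simp

lemma measurable_prod_sgn (F : Finset ι) : Measurable fun u : ι → Bool => ∏ j ∈ F, sgn (u j) :=
  Finset.measurable_fun_prod F fun j _ => (measurable_of_countable sgn).comp (measurable_pi_apply j)

lemma measurable_parityField (B : ι → Finset ι) : Measurable (parityField B) := by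
  refine measurable_pi_lambda _ fun i => measurable_to_bool ?_
  have e : (fun u => parityField B u i) ⁻¹' {true} = {u | ∏ j ∈ B i, sgn (u j) = -1} := by
    ext u
    simp [parityField]
  rw [e]
  exact measurableSet_eq_fun (measurable_prod_sgn _) measurable_const

lemma integral_sgn_bernoulli (p : unitInterval) :
    ∫ b, sgn b ∂bernoulliMeasure true false p = 1 - 2 * p := by
  rw [integral_bernoulli, sgn_true, sgn_false]
  ring

variable (p : ι → unitInterval)

/-- The law of independent bits with parameters `p i`. -/
noncomputable def bits : Measure (ι → Bool) :=
  Measure.infinitePi fun i => bernoulliMeasure true false (p i)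

instance instIsProbabilityMeasureBits : IsProbabilityMeasure (bits p) := by
  unfold bits; infer_instance

/-- The first Griffiths inequality for parities of independent bits. -/
lemma integral_prod_parityField_nonneg (hp : ∀ i, (p i : ℝ) ≤ 1 / 2) (B : ι → Finset ι)
    (R : Finset ι) : 0 ≤ ∫ u, ∏ i ∈ R, sgn (parityField B u i) ∂bits p := by
  classical
  -- Collecting the exponent of each bit factorizes the expectation: even exponents contribute `1`,
  -- odd ones `1 - 2 p_j ≥ 0`.
  have e (u : ι → Bool) : ∏ i ∈ R, sgn (parityField B u i) =
      ∏ j ∈ R.biUnion B, sgn (u j) ^ (R.filter fun i => j ∈ B i).card := by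
    have h1 (i : ι) (hi : i ∈ R) : sgn (parityField B u i) =
        ∏ j ∈ R.biUnion B, if j ∈ B i then sgn (u j) else 1 := by
      rw [sgn_parityField, Finset.prod_ite_mem,
        Finset.inter_eq_right.2 (Finset.subset_biUnion_of_mem B hi)]
    rw [Finset.prod_congr rfl h1, Finset.prod_comm]
    refine Finset.prod_congr rfl fun j _ => ?_
    rw [Finset.prod_ite, Finset.prod_const, Finset.prod_const_one, mul_one]
  simp_rw [e]
  rw [bits, integral_prod_infinitePi _ _
    (fun j b => sgn b ^ (R.filter fun i => j ∈ B i).card) fun _ => measurable_of_countable _]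
  refine Finset.prod_nonneg fun j _ => ?_
  rw [integral_bernoulli]
  have := hp j
  have h0 := (p j).2.1
  rcases Nat.even_or_odd (R.filter fun i => j ∈ B i).card with h | h
  · simp [h.neg_one_pow]
  · simp only [sgn_true, sgn_false, h.neg_one_pow, one_pow]
    linarith

/-- Flip the bits at the sites in `D`. -/
def flip (D : Set ι) [DecidablePred (· ∈ D)] (u : ι → Bool) (i : ι) : Bool :=
  if i ∈ D then !u i else u i

lemma measurable_flip (D : Set ι) [DecidablePred (· ∈ D)] : Measurable (flip D) := by
  refine measurable_pi_lambda _ fun i => ?_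
  by_cases h : i ∈ D
  · simp only [flip, h, if_true]
    exact (measurable_of_countable not).comp (measurable_pi_apply i)
  · simp only [flip, h, if_false]
    exact measurable_pi_apply i

/-- Flipping a single bit changes probabilities at most by a factor `3`. -/
lemma bits_flip_singleton_le [DecidableEq ι] (hp : ∀ i, (1 / 4 : ℝ) ≤ p i ∧ (p i : ℝ) ≤ 3 / 4)
    (j : ι) {E : Set (ι → Bool)} (hE : MeasurableSet E) :
    bits p (flip {j} ⁻¹' E) ≤ 3 * bits p E := by
  have hup (c : Bool) : MeasurableSet {u : ι → Bool | Function.update u j c ∈ E} :=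
    by
    have h : Measurable fun u : ι → Bool => Function.update u j c := measurable_update_left
    exact h hE
  have hinter (G : Set (ι → Bool)) (c : Bool) (hG : MeasurableSet G)
      (hinv : ∀ x y : ι → Bool, (∀ i ≠ j, x i = y i) → (x ∈ G ↔ y ∈ G)) :
      bits p (G ∩ {u | u j = c}) = bits p G * bernoulliMeasure true false (p j) {c} :=
    infinitePi_inter_eval (fun i => bernoulliMeasure true false (p i)) j hG hinv
      (C := {c}) MeasurableSet.of_discrete
  have hinv (c : Bool) (x y : ι → Bool) (h : ∀ i ≠ j, x i = y i) :
      (x ∈ {u : ι → Bool | Function.update u j c ∈ E} ↔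
        y ∈ {u : ι → Bool | Function.update u j c ∈ E}) := by
    have : Function.update x j c = Function.update y j c := by
      funext i
      by_cases hi : i = j
      · subst hi; simp
      · simp [hi, h i hi]
    simp only [Set.mem_ofPred_eq, this]
  have hsite (c : Bool) : MeasurableSet {u : ι → Bool | u j = c} :=
    measurableSet_eq_fun (measurable_pi_apply j) measurable_const
  have hsplit (G : Set (ι → Bool)) : bits p G =
      bits p (G ∩ {u | u j = true}) + bits p (G ∩ {u | u j = false}) := by
    rw [← measure_inter_add_sdiff G (hsite true)]
    congr 2
    ext u
    simp
  have e1 (c : Bool) : E ∩ {u | u j = c} =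
      {u : ι → Bool | Function.update u j c ∈ E} ∩ {u | u j = c} := by
    ext u
    simp only [Set.mem_inter_iff, Set.mem_ofPred_eq, and_congr_left_iff]
    rintro rfl
    rw [Function.update_eq_self]
  have e2 (c : Bool) : flip {j} ⁻¹' E ∩ {u | u j = c} =
      {u : ι → Bool | Function.update u j (!c) ∈ E} ∩ {u | u j = c} := by
    ext u
    simp only [Set.mem_inter_iff, Set.mem_ofPred_eq, and_congr_left_iff, Set.mem_preimage]
    rintro rfl
    have : flip {j} u = Function.update u j (!u j) := by
      funext i
      by_cases hi : i = j
      · subst hi; simp [flip]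
      · simp [flip, hi]
    rw [this]
  -- The ratio `3` is attained at the endpoints `p = 1/4` and `p = 3/4`.
  have hle (c : Bool) : bernoulliMeasure true false (p j) {!c} ≤
      3 * bernoulliMeasure true false (p j) {c} := by
    have h := measureReal_bernoulli (p j)
    have := hp j
    rw [← ENNReal.toReal_le_toReal (measure_ne_top _ _)
      (ENNReal.mul_ne_top (by norm_num) (measure_ne_top _ _)), ENNReal.toReal_mul]
    simp only [← measureReal_def]
    cases c <;> simp [h] <;> linarith
  rw [hsplit (flip {j} ⁻¹' E), hsplit E, e1, e1, e2, e2,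
    hinter _ _ (hup _) (hinv _), hinter _ _ (hup _) (hinv _), hinter _ _ (hup _) (hinv _),
    hinter _ _ (hup _) (hinv _), mul_add, add_comm]
  have h1 := hle true
  have h2 := hle false
  simp only [Bool.not_true, Bool.not_false] at h1 h2 ⊢
  refine add_le_add ?_ ?_
  · rw [mul_left_comm]; exact mul_le_mul_right h1 _
  · rw [mul_left_comm]; exact mul_le_mul_right h2 _

lemma bits_flip_le [DecidableEq ι] (hp : ∀ i, (1 / 4 : ℝ) ≤ p i ∧ (p i : ℝ) ≤ 3 / 4)
    (D : Finset ι) {E : Set (ι → Bool)} (hE : MeasurableSet E) :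
    bits p (flip (D : Set ι) ⁻¹' E) ≤ 3 ^ D.card * bits p E := by
  induction D using Finset.induction_on with
  | empty =>
    have : flip ((∅ : Finset ι) : Set ι) = id := by funext u i; simp [flip]
    simp [this]
  | insert j D hj ih =>
    have e : flip ((insert j D : Finset ι) : Set ι) = flip (D : Set ι) ∘ flip {j} := by
      funext u i
      by_cases hi : i = j
      · subst hi; simp [flip, hj]
      · simp [flip, hi]
    rw [e, Set.preimage_comp, Finset.card_insert_of_notMem hj, pow_succ', mul_assoc]
    exact (bits_flip_singleton_le p hp j (measurable_flip _ hE)).trans (mul_le_mul_right ih _)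

lemma prod_sgn_flip [DecidableEq ι] (D F : Finset ι) (u : ι → Bool) :
    ∏ j ∈ F, sgn (flip (D : Set ι) u j) = (-1) ^ (F ∩ D).card * ∏ j ∈ F, sgn (u j) := by
  have h (j : ι) : sgn (flip (D : Set ι) u j) = (if j ∈ D then -1 else 1) * sgn (u j) := by
    by_cases hj : j ∈ D <;> simp [flip, hj, sgn_not]
  simp_rw [h]
  rw [Finset.prod_mul_distrib, Finset.prod_ite, Finset.prod_const, Finset.prod_const_one, mul_one,
    Finset.filter_mem_eq_inter]

/-- If flipping at most two of the underlying bits flips only the value at `s` of the parity field,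
then the parity field is insertion tolerant at `s`. -/
lemma map_parityField_le [DecidableEq ι] (hp : ∀ i, (1 / 4 : ℝ) ≤ p i ∧ (p i : ℝ) ≤ 3 / 4)
    (B : ι → Finset ι) (s : ι) (D : Finset ι) (hD : D.card ≤ 2)
    (hodd : ∀ i, Odd (B i ∩ D).card ↔ i = s) {A : Set (ι → Bool)}
    (hA : MeasurableSet[cylinderEvents ({s}ᶜ : Set ι)] A) :
    (bits p).map (parityField B) A ≤
      10 * (bits p).map (parityField B) (A ∩ {τ | τ s = true}) := by
  have hA' : MeasurableSet A := cylinderEvents_le_pi _ hA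
  have hB := measurable_parityField B
  rw [Measure.map_apply hB hA', Measure.map_apply hB (hA'.inter (measurableSet_site s))]
  set E := parityField B ⁻¹' (A ∩ {τ | τ s = true})
  have hE : MeasurableSet E := hB (hA'.inter (measurableSet_site s))
  -- Either `s` is already occupied, or flipping `D` occupies it without leaving `A`. The cost is `1
  -- + 3^2 = 10`.
  have hsub : parityField B ⁻¹' A ⊆ E ∪ flip (D : Set ι) ⁻¹' E := by
    intro u hu
    have hne (i : ι) (hi : i ≠ s) : parityField B (flip (D : Set ι) u) i = parityField B u i := by
      refine sgn_injective ?_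
      have he : Even (B i ∩ D).card := Nat.not_odd_iff_even.1 fun h => hi ((hodd i).1 h)
      rw [sgn_parityField, sgn_parityField, prod_sgn_flip, he.neg_one_pow, one_mul]
    have heq : parityField B (flip (D : Set ι) u) s = !parityField B u s := by
      refine sgn_injective ?_
      rw [sgn_not, sgn_parityField, sgn_parityField, prod_sgn_flip, ((hodd s).2 rfl).neg_one_pow,
        neg_one_mul]
    by_cases h : parityField B u s = true
    · exact .inl ⟨hu, h⟩
    · refine .inr ⟨(mem_iff_of_cylinderEvents hA fun i hi => (hne i hi).symm).1 hu, ?_⟩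
      simp [heq, h]
  calc bits p (parityField B ⁻¹' A) ≤ bits p E + bits p (flip (D : Set ι) ⁻¹' E) :=
        (measure_mono hsub).trans (measure_union_le _ _)
    _ ≤ bits p E + 3 ^ D.card * bits p E := by gcongr; exact bits_flip_le p hp D hE
    _ ≤ bits p E + 3 ^ 2 * bits p E := by
        gcongr
        norm_num
    _ = 10 * bits p E := by ring

end Parity

/-! ### An insertion tolerant measure that is not upwards extractable. -/

section ParityBlocks

/-- The sets whose parities define the parity blocks: a site `i` with `n ∣ i + k + 1` is the last
site of a block of size `n` and carries the parity of that block, all other sites carry their own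
bits. -/
noncomputable def parityBlock (n k : ℕ) (i : ℤ) : Finset ℤ :=
  if (n : ℤ) ∣ i + k + 1 then Finset.Ioc (i - n) i else {i}

/-- The parameters of the bits defining the parity blocks: only the bits at the last sites of the
blocks are biased. -/
noncomputable def parityParam (n k : ℕ) (i : ℤ) : unitInterval :=
  if (n : ℤ) ∣ i + k + 1 then quarter else half

lemma parityParam_mem (n k : ℕ) (i : ℤ) :
    (1 / 4 : ℝ) ≤ parityParam n k i ∧ (parityParam n k i : ℝ) ≤ 1 / 2 := by
  unfold parityParam
  split_ifs
  · rw [coe_quarter]; norm_num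
  · rw [coe_half]; norm_num

/-- The law of independent blocks of size `n` which are uniform up to a bias of their parities. -/
noncomputable def parityLaw (n k : ℕ) : Measure (ℤ → Bool) :=
  (bits (parityParam n k)).map (parityField (parityBlock n k))

lemma parityLaw_isProbabilityMeasure (n k : ℕ) : IsProbabilityMeasure (parityLaw n k) :=
  Measure.isProbabilityMeasure_map (measurable_parityField _).aemeasurable

lemma map_shift_parityLaw (n k : ℕ) :
    (parityLaw n k).map (fun (σ : ℤ → Bool) (i : ℤ) => σ (i + 1)) = parityLaw n (k + 1) := by
  have hbits : (bits (parityParam n k)).map (fun (u : ℤ → Bool) (i : ℤ) => u (i + 1)) =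
      bits (parityParam n (k + 1)) := by
    rw [bits, Measure.map_infinitePi_infinitePi_of_inj (f := fun i : ℤ => i + 1)
      (add_left_injective 1), bits]
    congr 1
    funext i
    have e : i + 1 + (k : ℤ) + 1 = i + (k + 1 : ℕ) + 1 := by push_cast; ring
    simp only [parityParam, e]
  rw [parityLaw, Measure.map_map (measurable_shift 1) (measurable_parityField _), parityLaw,
    ← hbits, Measure.map_map (measurable_parityField _) (measurable_shift 1)]
  congr 1
  funext u i
  refine sgn_injective ?_
  simp only [Function.comp_apply]
  rw [sgn_parityField, sgn_parityField]
  have e : i + 1 + (k : ℤ) + 1 = i + (k + 1 : ℕ) + 1 := by push_cast; ring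
  have e' : parityBlock n k (i + 1) = (parityBlock n (k + 1) i).map (addRightEmbedding 1) := by
    unfold parityBlock
    rw [e]
    split_ifs
    · rw [Finset.map_add_right_Ioc]
      congr 1
      ring
    · simp
  rw [e', Finset.prod_map]
  rfl

lemma parityLaw_self (n : ℕ) : parityLaw n n = parityLaw n 0 := by
  have e (i : ℤ) : (n : ℤ) ∣ i + n + 1 ↔ (n : ℤ) ∣ i + (0 : ℕ) + 1 := by
    rw [show i + (n : ℤ) + 1 = i + (0 : ℕ) + 1 + n by push_cast; ring, dvd_add_self_right]
  have h1 : parityParam n n = parityParam n 0 := by funext i; simp only [parityParam, e]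
  have h2 : parityBlock n n = parityBlock n 0 := by funext i; simp only [parityBlock, e]
  rw [parityLaw, parityLaw, h1, h2]

/-- Flip the bits at `s` and at the last site `e` of its block: the block parity carried by `e`
changes twice, so only `s` changes. If `s = e`, the pair collapses to a single flip. -/
lemma parityLaw_le {n : ℕ} (hn : n ≠ 0) (k : ℕ) (s : ℤ) {A : Set (ℤ → Bool)}
    (hA : MeasurableSet[cylinderEvents ({s}ᶜ : Set ℤ)] A) :
    parityLaw n k A ≤ 10 * parityLaw n k (A ∩ {τ | τ s = true}) := by
  have hn' : (0 : ℤ) < n := by omega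
  obtain ⟨e, he, hse, hes⟩ : ∃ e : ℤ, (n : ℤ) ∣ e + k + 1 ∧ s ≤ e ∧ e < s + n := by
    refine ⟨s + (-(s + k + 1)) % n, ?_, ?_, ?_⟩
    · have := Int.emod_add_mul_ediv (-(s + k + 1)) n
      exact ⟨-(-(s + k + 1) / n), by linarith⟩
    · have := Int.emod_nonneg (-(s + k + 1)) hn'.ne'
      linarith
    · have := Int.emod_lt_of_pos (-(s + k + 1)) hn'
      linarith
  have huniq (i : ℤ) (hi : (n : ℤ) ∣ i + k + 1) (hie : i ≠ e) : i ≤ e - n ∨ e + n ≤ i := by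
    obtain ⟨t, ht⟩ := (Int.dvd_sub hi he)
    have ht' : i - e = n * t := by linarith
    rcases lt_trichotomy t 0 with h | h | h
    · left; nlinarith
    · subst h; exact absurd (by linarith) hie
    · right; nlinarith
  refine map_parityField_le _ (fun i => ⟨(parityParam_mem n k i).1,
    (parityParam_mem n k i).2.trans (by norm_num)⟩) _ s {s, e} Finset.card_le_two
    (fun i => ?_) hA
  unfold parityBlock
  split_ifs with hi
  · by_cases hie : i = e
    · subst hie
      have h : Finset.Ioc (i - n) i ∩ {s, i} = {s, i} := by
        refine Finset.inter_eq_right.2 fun x hx => ?_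
        simp only [Finset.mem_insert, Finset.mem_singleton] at hx
        rw [Finset.mem_Ioc]
        omega
      rw [h]
      by_cases hsi : s = i
      · simp [hsi]
      · rw [Finset.card_pair hsi]
        exact iff_of_false (by decide) (Ne.symm hsi)
    · have hi' := huniq i hi hie
      have h : Finset.Ioc (i - n) i ∩ {s, e} = ∅ := by
        ext x
        simp only [Finset.mem_inter, Finset.mem_Ioc, Finset.mem_insert, Finset.mem_singleton,
          Finset.notMem_empty, iff_false]
        omega
      rw [h]
      refine iff_of_false (by simp) fun his => ?_
      omega
  · have hie : i ≠ e := fun h => hi (h ▸ he)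
    by_cases his : i = s
    · subst his
      have h : ({i} : Finset ℤ) ∩ {i, e} = {i} := by
        rw [Finset.inter_eq_left, Finset.singleton_subset_iff]
        exact Finset.mem_insert_self _ _
      simp [h]
    · simp [his, hie]

lemma dyadicParity_isProbabilityMeasure : IsProbabilityMeasure (dyadicMixture parityLaw) :=
  dyadicMixture_isProbabilityMeasure parityLaw_isProbabilityMeasure

lemma dyadicParity_translationInvariant : TranslationInvariant (dyadicMixture parityLaw) :=
  dyadicMixture_translationInvariant map_shift_parityLaw fun n _ => parityLaw_self n

/-- The event form of insertion tolerance is linear in the measure, so the scale-free constant `10`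
passes to the mixture. -/
lemma dyadicParity_uniformlyInsertionTolerant :
    UniformlyInsertionTolerant (dyadicMixture parityLaw) := by
  have := dyadicParity_isProbabilityMeasure
  refine ⟨1 / 10, by norm_num, insertionTolerant_of_measure _ fun s A hA => ?_⟩
  have hA' : MeasurableSet A := cylinderEvents_le_pi _ hA
  have h := dyadicMixture_le_mul (m := parityLaw) 10 hA' (hA'.inter (measurableSet_site s))
    fun n k hn => parityLaw_le hn k s hA
  have h' := ENNReal.toReal_mono (ENNReal.mul_ne_top (by norm_num) (measure_ne_top _ _)) h
  rw [ENNReal.toReal_mul] at h'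
  simp only [← measureReal_def, ENNReal.toReal_ofNat] at h'
  linarith

lemma integral_prod_sgn_parityLaw_nonneg (R : Finset ℤ) (n k : ℕ) :
    0 ≤ ∫ σ, ∏ i ∈ R, sgn (σ i) ∂parityLaw n k := by
  rw [parityLaw, integral_map (measurable_parityField _).aemeasurable
    (measurable_prod_sgn R).aestronglyMeasurable]
  exact integral_prod_parityField_nonneg _ (fun i => (parityParam_mem n k i).2) _ R

/-- The signs of the block telescope to that of its last underlying bit, which has parameter `1/4`
and mean sign `1 - 2/4`. -/
lemma integral_prod_sgn_block {n : ℕ} (hn : n ≠ 0) :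
    ∫ σ, ∏ i ∈ Finset.Ioc (-1 - n : ℤ) (-1), sgn (σ i) ∂parityLaw n 0 = 1 / 2 := by
  have hn' : (0 : ℤ) < n := by omega
  rw [parityLaw, integral_map (measurable_parityField _).aemeasurable
    (measurable_prod_sgn _).aestronglyMeasurable]
  have hmem : (-1 : ℤ) ∈ Finset.Ioc (-1 - n : ℤ) (-1) := by rw [Finset.mem_Ioc]; omega
  have e (u : ℤ → Bool) : ∏ i ∈ Finset.Ioc (-1 - n : ℤ) (-1),
      sgn (parityField (parityBlock n 0) u i) = sgn (u (-1)) := by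
    rw [← Finset.mul_prod_erase _ _ hmem]
    have h1 : sgn (parityField (parityBlock n 0) u (-1)) =
        ∏ i ∈ Finset.Ioc (-1 - n : ℤ) (-1), sgn (u i) := by
      rw [sgn_parityField]
      simp [parityBlock]
    have h2 : ∏ i ∈ (Finset.Ioc (-1 - n : ℤ) (-1)).erase (-1),
        sgn (parityField (parityBlock n 0) u i) =
        ∏ i ∈ (Finset.Ioc (-1 - n : ℤ) (-1)).erase (-1), sgn (u i) := by
      refine Finset.prod_congr rfl fun i hi => ?_
      rw [Finset.mem_erase, Finset.mem_Ioc] at hi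
      have hnd : ¬ (n : ℤ) ∣ i + (0 : ℕ) + 1 := fun h => by
        have h' : (n : ℤ) ∣ -(i + (0 : ℕ) + 1) := (dvd_neg).2 h
        have := Int.le_of_dvd (by push_cast; omega) h'
        push_cast at this
        omega
      rw [sgn_parityField, parityBlock, if_neg hnd, Finset.prod_singleton]
    rw [h1, h2, ← Finset.mul_prod_erase _ _ hmem, mul_assoc, ← Finset.prod_mul_distrib]
    simp [sgn_mul_self]
  simp_rw [e]
  have h := integral_prod_infinitePi (fun i => bernoulliMeasure true false (parityParam n 0 i))
    {-1} (fun _ => sgn) fun _ => measurable_of_countable _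
  simp only [Finset.prod_singleton] at h
  rw [bits, h, integral_sgn_bernoulli, parityParam, if_pos (by simp), coe_quarter]
  norm_num

lemma norm_prod_sgn_le {ι : Type*} (R : Finset ι) (σ : ι → Bool) : ‖∏ i ∈ R, sgn (σ i)‖ ≤ 1 := by
  rcases prod_sgn_eq_or R σ with h | h <;> rw [h] <;> simp

/-- A test function bounded in expectation under upwards extractable measures. -/
lemma integral_prod_plusNoise_le {S : Type*} [Countable S] (ν : Measure (S → Bool))
    [IsProbabilityMeasure ν] (ε : unitInterval) (hε : (ε : ℝ) < 1) (T : Finset S) :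
    ∫ σ, ∏ i ∈ T, ((1 - ε : ℝ)⁻¹ * sgn (σ i) + ε * (1 - ε : ℝ)⁻¹) ∂plusNoise ν ε ≤ 1 := by
  have h1 : (1 - ε : ℝ) ≠ 0 := by linarith
  -- `h` inverts the noise at one site: the mean of `h (x || y)` over `y` is `sgn x`.
  set h : Bool → ℝ := fun b => (1 - ε : ℝ)⁻¹ * sgn b + ε * (1 - ε : ℝ)⁻¹ with hh
  have hc : Continuous fun σ : S → Bool => ∏ i ∈ T, h (σ i) :=
    continuous_finsetProd T fun i _ =>
      (continuous_of_discreteTopology (f := h)).comp (continuous_apply i)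
  have e (x : S → Bool) : ∫ y, ∏ i ∈ T, h (x i || y i) ∂prodBer S ε = ∏ i ∈ T, sgn (x i) := by
    rw [prodBer, integral_prod_infinitePi _ T (fun i b => h (x i || b))
      fun _ => measurable_of_countable _]
    refine Finset.prod_congr rfl fun i _ => ?_
    rw [integral_bernoulli]
    cases x i <;> simp [hh] <;> field_simp <;> ring
  change ∫ σ, ∏ i ∈ T, h (σ i) ∂plusNoise ν ε ≤ 1
  rw [integral_plusNoise _ _ hc]
  simp_rw [e]
  have := norm_integral_le_of_norm_le_const (μ := ν)
    (.of_forall fun σ : S → Bool => norm_prod_sgn_le T σ)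
  rw [probReal_univ, mul_one] at this
  exact (le_abs_self _).trans this

lemma dyadicParity_not_uniformlyUpwardsExtractable :
    ¬ UniformlyUpwardsExtractable (dyadicMixture parityLaw) := by
  rintro ⟨ε, h0, h1, ν, hν, hμ⟩
  have hprob := dyadicParity_isProbabilityMeasure
  have h0' : (0 : ℝ) < ε := h0
  have h1' : (ε : ℝ) < 1 := h1
  have hpos : 0 < (1 - ε : ℝ) := by linarith
  -- Expanding the test function over subsets of the block gives nonnegative terms only; the term of
  -- the full block is kept, bounded below by the contribution of the aligned law at scale `2^j`.
  have key (j : ℕ) : (1 - ε : ℝ)⁻¹ ^ 2 ^ j * (dyadicWeight j * (1 / 2)) ≤ 1 := by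
    have hj : 2 ^ j ≠ 0 := by positivity
    set T := Finset.Ioc (-1 - (2 ^ j : ℕ) : ℤ) (-1)
    have hT : T.card = 2 ^ j := by
      have (N : ℕ) : (-1 - (-1 - (N : ℤ))).toNat = N := by omega
      rw [Int.card_Ioc, this]
    have hup := integral_prod_plusNoise_le ν ε h1' T
    rw [← hμ] at hup
    simp_rw [Finset.prod_add, Finset.prod_mul_distrib, Finset.prod_const] at hup
    rw [integral_finsetSum] at hup
    · refine le_trans ?_ hup
      simp_rw [integral_mul_const, integral_const_mul]
      refine le_trans ?_ (Finset.single_le_sum (f := fun R => (1 - ε : ℝ)⁻¹ ^ R.card *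
        (∫ σ, ∏ i ∈ R, sgn (σ i) ∂dyadicMixture parityLaw) *
          (ε ^ (T \ R).card * (1 - ε : ℝ)⁻¹ ^ (T \ R).card)) (fun R _ => ?_)
        (Finset.mem_powerset_self T))
      · simp only [Finset.sdiff_self, Finset.card_empty, pow_zero, mul_one, hT]
        refine mul_le_mul_of_nonneg_left ?_ (by positivity)
        rw [← integral_prod_sgn_block hj]
        exact mul_le_integral_dyadicMixture parityLaw_isProbabilityMeasure
          (measurable_prod_sgn T) (norm_prod_sgn_le T) (integral_prod_sgn_parityLaw_nonneg T) j
      · have := integral_dyadicMixture_nonneg parityLaw_isProbabilityMeasure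
          (measurable_prod_sgn R) (norm_prod_sgn_le R) (integral_prod_sgn_parityLaw_nonneg R)
        positivity
    · intro R _
      have : Integrable (fun σ : ℤ → Bool => ∏ i ∈ R, sgn (σ i)) (dyadicMixture parityLaw) :=
        .of_bound (measurable_prod_sgn R).aestronglyMeasurable 1
          (.of_forall (norm_prod_sgn_le R))
      exact (this.const_mul _).mul_const _
  -- With `n = 2^j` the weight is `1 / (2 n^2)`, so `key` fails as soon as `n^2 (1-ε)^n < 1/4`.
  have hlim := (tendsto_pow_const_mul_const_pow_of_abs_lt_one 2
    (r := (1 - ε : ℝ)) (by rw [abs_of_pos hpos]; linarith)).comp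
    (tendsto_pow_atTop_atTop_of_one_lt (α := ℕ) (r := 2) (by norm_num))
  obtain ⟨j, hj⟩ := (hlim.eventually (gt_mem_nhds (by norm_num : (0 : ℝ) < 1 / 4))).exists
  have hk := key j
  simp only [Function.comp_apply] at hj
  have hw : dyadicWeight j = 1 / (2 * ((2 : ℝ) ^ j) ^ 2) := by
    unfold dyadicWeight
    rw [inv_pow, pow_succ]
    field_simp
  rw [hw, inv_pow] at hk
  push_cast at hj
  have hX : 0 < (1 - ε : ℝ) ^ 2 ^ j := by positivity
  have hY : (0 : ℝ) < ((2 : ℝ) ^ j) ^ 2 := by positivity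
  rw [show ((1 - ε : ℝ) ^ 2 ^ j)⁻¹ * (1 / (2 * ((2 : ℝ) ^ j) ^ 2) * (1 / 2)) =
    1 / (4 * (((2 : ℝ) ^ j) ^ 2 * (1 - ε : ℝ) ^ 2 ^ j)) by field_simp; norm_num,
    div_le_one (by positivity)] at hk
  linarith

end ParityBlocks

end Domination

theorem theorem1p5 :
    -- the implications, for every nonempty countable set of sites
    (∀ (S : Type*) [Countable S] [Nonempty S] (μ : Measure (S → Bool)) [IsProbabilityMeasure μ],
      (Domination.UniformlyUpwardsExtractable μ → Domination.UniformlyInsertionTolerant μ) ∧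
      (Domination.UniformlyInsertionTolerant μ → Domination.DominatesProduct μ) ∧
      (Domination.UniformlyUpwardsExtractable μ → Domination.Rigid μ) ∧
      (Domination.Rigid μ → Domination.DominatesProduct μ)) ∧
    -- uniform insertion tolerance does not imply uniform upwards extractability
    (∃ μ : Measure (ℤ → Bool), IsProbabilityMeasure μ ∧ Domination.TranslationInvariant μ ∧
      Domination.UniformlyInsertionTolerant μ ∧ ¬ Domination.UniformlyUpwardsExtractable μ) ∧
    -- domination of a nontrivial product measure does not imply uniform insertion tolerance
    (∃ μ : Measure (ℤ → Bool), IsProbabilityMeasure μ ∧ Domination.TranslationInvariant μ ∧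
      Domination.DominatesProduct μ ∧ ¬ Domination.UniformlyInsertionTolerant μ) ∧
    -- rigidity does not imply uniform upwards extractability
    (∃ μ : Measure (ℤ → Bool), IsProbabilityMeasure μ ∧ Domination.TranslationInvariant μ ∧
      Domination.Rigid μ ∧ ¬ Domination.UniformlyUpwardsExtractable μ) ∧
    -- domination of a nontrivial product measure does not imply rigidity
    (∃ μ : Measure (ℤ → Bool), IsProbabilityMeasure μ ∧ Domination.TranslationInvariant μ ∧
      Domination.DominatesProduct μ ∧ ¬ Domination.Rigid μ) ∧
    -- rigidity does not imply uniform insertion tolerance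
    (∃ μ : Measure (ℤ → Bool), IsProbabilityMeasure μ ∧ Domination.TranslationInvariant μ ∧
      Domination.Rigid μ ∧ ¬ Domination.UniformlyInsertionTolerant μ) := by
  open Domination in
  exact ⟨fun S _ _ μ _ => ⟨UniformlyUpwardsExtractable.uniformlyInsertionTolerant,
      UniformlyInsertionTolerant.dominatesProduct, UniformlyUpwardsExtractable.rigid,
      Rigid.dominatesProduct⟩,
    ⟨_, dyadicParity_isProbabilityMeasure, dyadicParity_translationInvariant,
      dyadicParity_uniformlyInsertionTolerant, dyadicParity_not_uniformlyUpwardsExtractable⟩,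
    ⟨_, inferInstance, neighbourMaxLaw_translationInvariant,
      neighbourMaxLaw_rigid.dominatesProduct, neighbourMaxLaw_not_uniformlyInsertionTolerant⟩,
    ⟨_, inferInstance, neighbourMaxLaw_translationInvariant, neighbourMaxLaw_rigid,
      fun h => neighbourMaxLaw_not_uniformlyInsertionTolerant h.uniformlyInsertionTolerant⟩,
    ⟨_, dyadicBlocks_isProbabilityMeasure, dyadicBlocks_translationInvariant,
      dyadicBlocks_dominatesProduct, dyadicBlocks_not_rigid⟩,
    ⟨_, inferInstance, neighbourMaxLaw_translationInvariant, neighbourMaxLaw_rigid,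
      neighbourMaxLaw_not_uniformlyInsertionTolerant⟩⟩
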